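/- **Setting.** Let $P,H,M,Q$ be real Hilbert spaces, where $P$ is continuously, injectively and densely embedded in $H$, so that $P\hookrightarrow H\cong H^*\hookrightarrow P^*$ is a Gelfand triple. Let $$A\colon H\to H^*,\qquad K\colon P\to M^*,\qquad D\colon M\to M^*,\qquad B\colon P\to Q^*$$ be bounded linear operators, and let $K^*\colon M\to P^*$, $B^*\colon Q\to P^*$ be the dual operators. Put $P_{\ker}:=\ker B\subseteq P$ and let $H_{\ker}$ be the closure of $P_{\ker}$ in $H$. Assume that there are constants $c_D,c_K,\beta>0$ such that - $\langle Dm,m\rangle\ge c_D\|m\|_M^2$ for all $m\in M$, - $\|Kq\|_{M^*}\ge c_K\|q\|_P$ for all $q\in P_{\ker}$, - $\displaystyle\inf_{\mu\in Q\setminus\{0\}}\ \sup_{q\in P\setminus\{0\}}\frac{\langle Bq,\mu\rangle}{\|q\|_P\|\mu\|_Q}\ge\beta$. Let $B^-\colon Q^*\to P$ be the right inverse of $B$ with values in $P_{\ker}^{\perp}$, and let $L:=K^*D^{-1}K\colon P\to P^*$. **Data.** Let $T>0$, $f\in H^1(0,T;M^*)$, $h\in H^2(0,T;Q^*)$, and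 let $g\in L^2(0,T;P^*)$ be such that its restriction $t\mapsto g(t)|_{P_{\ker}}$ has a weak derivative in $L^2(0,T;P_{\ker}^*)$; so $f$, $h$, $\dot h$ and $g|_{P_{\ker}}$ have continuous representatives and values at $t=0$. Let $p^0\in P$ satisfy $Bp^0=h(0)$, and assume that there is $\mathfrak p\in H_{\ker}$ with $$(\mathfrak p,q)_H=\big\langle g(0)-(L+A)p^0-B^-\dot h(0)+K^*D^{-1}f(0),\,q\big\rangle\qquad\text{for all }q\in P_{\ker}.$$ **Weak solutions.** For $\gamma\in L^2(0,T;P^*)$, $r\in L^2(0,T;M^*)$, $\eta\in L^2(0,T;Q^*)$ and $x\in H$, a weak solution of $$\dot p+Ap-K^*m+B^*\lambda=\gamma\ \text{ in }P^*,\qquad Kp+Dm=r\ \text{ in }M^*,\qquad Bp=\eta\ \text{ in }Q^*,\qquad p(0)=x$$ is a triple $(p,m,\lambda)$ with $p\in L^2(0,T;P)\cap C([0,T],H)$, $m\in L^2(0,T;M)$ and $\lambda$ a $Q$-valued distribution on $(0,T)$, such that $p(0)=x$ in $H$, the first equation holds in the sense of $P^*$-valued distributions on $(0,T)$, and the other two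 hold for almost every $t\in(0,T)$. **Claim.** The limit system, i.e. the system with right-hand sides $(\gamma,r,\eta)=(g,f,h)$ and $x=p^0$, has a weak solution. For every weak solution $(p_0,m_0,\lambda_0)$ of it, $m_0\in H^1(0,T;M)$, and the first-order corrector system $$\dot p_1+Ap_1-K^*m_1+B^*\lambda_1=0\ \text{ in }P^*,\qquad Kp_1+Dm_1=-\dot m_0\ \text{ in }M^*,\qquad Bp_1=0\ \text{ in }Q^*,\qquad p_1(0)=0$$ (where $M\cong M^*$ by the Riesz isomorphism) has a weak solution $(p_1,m_1,\lambda_1)$. It satisfies $$p_1\in L^2(0,T;P_{\ker})\cap C([0,T],H),\qquad m_1\in L^2(0,T;M),$$ $\lambda_1$ is a $Q$-valued distribution on $(0,T)$, and the weak solution is unique: any two weak solutions of the corrector system have almost everywhere equal components $p_1$ and $m_1$, and the same distribution $\lambda_1$. -/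

import Mathlib

open MeasureTheory Set TopologicalSpace
open scoped RealInnerProductSpace Distributions

noncomputable section

/-! ### Functions of time on `(0,T)` with values in a Banach space -/

section Bochner

variable {X : Type*} [NormedAddCommGroup X] [NormedSpace ℝ X]

/-- The open time interval `(0,T)`. -/
def timeInterval (T : ℝ) : Opens ℝ := ⟨Ioo 0 T, isOpen_Ioo⟩

/-- Lebesgue measure on `(0,T)`. -/
def timeMeasure (T : ℝ) : Measure ℝ := volume.restrict (Ioo 0 T)

/-- `u ∈ L²(0,T;X)`. -/
def MemL2 (T : ℝ) (u : ℝ → X) : Prop := MemLp u 2 (timeMeasure T)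

/-- `v` is the weak (distributional) time derivative of `u` on `(0,T)`:
`∫ φ' u = - ∫ φ v` for all `φ ∈ C_c^∞(0,T)`. -/
structure HasWeakDeriv (T : ℝ) (u v : ℝ → X) : Prop where
  locallyIntegrable_left : LocallyIntegrableOn u (Ioo 0 T) volume
  locallyIntegrable_right : LocallyIntegrableOn v (Ioo 0 T) volume
  integral_eq : ∀ φ : 𝓓(timeInterval T, ℝ),
    ∫ t, deriv φ t • u t ∂(timeMeasure T) = - ∫ t, φ t • v t ∂(timeMeasure T)

open Classical in
/-- The weak time derivative of `u` on `(0,T)` (unique up to null sets), and `0` if there is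
none. -/
def weakDeriv (T : ℝ) (u : ℝ → X) : ℝ → X :=
  if hu : ∃ v, HasWeakDeriv T u v then hu.choose else 0

/-- `u ∈ H¹(0,T;X)`. -/
def MemH1 (T : ℝ) (u : ℝ → X) : Prop :=
  MemL2 T u ∧ ∃ v, MemL2 T v ∧ HasWeakDeriv T u v

/-- `u ∈ H²(0,T;X)`. -/
def MemH2 (T : ℝ) (u : ℝ → X) : Prop :=
  MemL2 T u ∧ ∃ v, MemH1 T v ∧ HasWeakDeriv T u v

/-- `u` belongs to `C([0,T],X)`, in the sense that it agrees almost everywhere on `(0,T)` with a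
function that is continuous on `[0,T]`, and the value of this function at `0` is `x`. -/
def HasInitialValue (T : ℝ) (u : ℝ → X) (x : X) : Prop :=
  ∃ w : ℝ → X, ContinuousOn w (Icc 0 T) ∧ u =ᵐ[timeMeasure T] w ∧ w 0 = x

open Classical in
/-- The value `u(0)` of the representative of `u` that is continuous on `[0,T]`, and `0` if there
is no such representative. -/
def initialValue (T : ℝ) (u : ℝ → X) : X :=
  if hu : ∃ x, HasInitialValue T u x then hu.choose else 0

end Bochner

/-! ### The abstract system -/

/-- The inf-sup condition
`inf_{μ ≠ 0} sup_{q ≠ 0} ⟨B q, μ⟩ / (‖q‖ ‖μ‖) > 0` for `B : P → Q*`. -/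
def InfSupStable {P Q : Type*} [NormedAddCommGroup P] [InnerProductSpace ℝ P]
    [NormedAddCommGroup Q] [InnerProductSpace ℝ Q] (B : P →L[ℝ] StrongDual ℝ Q) : Prop :=
  ∃ β : ℝ, 0 < β ∧ ∀ μ : Q, μ ≠ 0 → β ≤ ⨆ q : {q : P // q ≠ 0}, B q.1 μ / (‖q.1‖ * ‖μ‖)

/-- Spaces and operators of the constrained system: a Gelfand triple `P ↪ H ≅ H* ↪ P*`, and bounded
operators `A : H → H*`, `K : P → M*`, `D : M → M*`, `B : P → Q*`, where `D` is elliptic, `B` is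
inf-sup stable and `K` is bounded from below on `ker B`. -/
structure ConstrainedSystem (P H M Q : Type*)
    [NormedAddCommGroup P] [InnerProductSpace ℝ P] [CompleteSpace P]
    [NormedAddCommGroup H] [InnerProductSpace ℝ H] [CompleteSpace H]
    [NormedAddCommGroup M] [InnerProductSpace ℝ M] [CompleteSpace M]
    [NormedAddCommGroup Q] [InnerProductSpace ℝ Q] [CompleteSpace Q] where
  /-- the embedding `P ↪ H` -/
  emb : P →L[ℝ] H
  emb_injective : Function.Injective emb
  emb_denseRange : DenseRange emb
  A : H →L[ℝ] StrongDual ℝ H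
  K : P →L[ℝ] StrongDual ℝ M
  D : M →L[ℝ] StrongDual ℝ M
  B : P →L[ℝ] StrongDual ℝ Q
  D_elliptic : ∃ c : ℝ, 0 < c ∧ ∀ m : M, c * ‖m‖ ^ 2 ≤ D m m
  B_infSup : InfSupStable B
  K_lower : ∃ c : ℝ, 0 < c ∧ ∀ q : P, B q = 0 → c * ‖q‖ ≤ ‖K q‖

namespace ConstrainedSystem

variable {P H M Q : Type*}
  [NormedAddCommGroup P] [InnerProductSpace ℝ P] [CompleteSpace P]
  [NormedAddCommGroup H] [InnerProductSpace ℝ H] [CompleteSpace H]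
  [NormedAddCommGroup M] [InnerProductSpace ℝ M] [CompleteSpace M]
  [NormedAddCommGroup Q] [InnerProductSpace ℝ Q] [CompleteSpace Q]
  (S : ConstrainedSystem P H M Q)

/-- `P_ker = ker B`, with the norm of `P`. -/
abbrev Pker : Submodule ℝ P := LinearMap.ker (S.B : P →ₗ[ℝ] StrongDual ℝ Q)

/-- `H_ker`, the closure of (the image of) `P_ker` in `H`. -/
def Hker : Submodule ℝ H := (S.Pker.map (S.emb : P →ₗ[ℝ] H)).topologicalClosure

/-- The embedding `H ≅ H* ↪ P*`, `x ↦ (q ↦ (x, q)_H)`. -/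
def embDual : H →L[ℝ] StrongDual ℝ P := ((innerSL ℝ).flip.comp S.emb).flip

@[simp] theorem embDual_apply (x : H) (q : P) : S.embDual x q = ⟪x, S.emb q⟫ := by
  simp only [embDual, ContinuousLinearMap.flip_apply, ContinuousLinearMap.comp_apply]
  rfl

/-- `A` as an operator `P → P*` along the Gelfand triple. -/
def AP : P →L[ℝ] StrongDual ℝ P :=
  ((ContinuousLinearMap.compL ℝ P H ℝ).flip S.emb).comp (S.A.comp S.emb)

@[simp] theorem AP_apply (p q : P) : S.AP p q = S.A (S.emb p) (S.emb q) := rfl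

/-- The dual operator `K* : M → P*`, `⟨K* m, q⟩ = ⟨K q, m⟩`. -/
def Kdual : M →L[ℝ] StrongDual ℝ P := S.K.flip

/-- The dual operator `B* : Q → P*`, `⟨B* μ, q⟩ = ⟨B q, μ⟩`. -/
def Bdual : Q →L[ℝ] StrongDual ℝ P := S.B.flip

theorem D_isInvertible : S.D.IsInvertible := by
  have hc : IsCoercive S.D := by
    obtain ⟨c, hc, h⟩ := S.D_elliptic
    exact ⟨c, hc, fun m => by simpa [pow_two, mul_assoc] using h m⟩
  refine ⟨hc.continuousLinearEquivOfBilin.trans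
    (InnerProductSpace.toDual ℝ M).toContinuousLinearEquiv, ?_⟩
  ext m n
  simp

/-- `D⁻¹ : M* → M`. -/
def Dinv : StrongDual ℝ M →L[ℝ] M := S.D.inverse

/-- `L = K* D⁻¹ K : P → P*`. -/
def L : P →L[ℝ] StrongDual ℝ P := S.Kdual.comp (S.Dinv.comp S.K)

theorem exists_lift (y : StrongDual ℝ Q) : ∃ q : P, q ∈ S.Pkerᗮ ∧ S.B q = y := by
  obtain ⟨β, hβ, h⟩ := S.B_infSup
  have key : ∀ μ : Q, β * ‖μ‖ ≤ ‖S.B.flip μ‖ := by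
    intro μ
    by_cases hμ : μ = 0
    · simp [hμ]
    have hμ' : 0 < ‖μ‖ := norm_pos_iff.2 hμ
    rw [← le_div_iff₀ hμ']
    refine (h μ hμ).trans (Real.iSup_le (fun q => ?_) (by positivity))
    have hq : 0 < ‖q.1‖ := norm_pos_iff.2 q.2
    rw [div_le_div_iff₀ (by positivity) hμ']
    have h1 : S.B q.1 μ ≤ ‖S.B.flip μ‖ * ‖q.1‖ :=
      (le_abs_self _).trans ((S.B.flip μ).le_opNorm q.1)
    nlinarith [mul_le_mul_of_nonneg_right h1 hμ'.le]
  let e₀ : StrongDual ℝ P ≃L[ℝ] P := (InnerProductSpace.toDual ℝ P).symm.toContinuousLinearEquiv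
  let R : Q →L[ℝ] P := (e₀ : StrongDual ℝ P →L[ℝ] P).comp S.B.flip
  have hR0 : ∀ μ, R μ = (InnerProductSpace.toDual ℝ P).symm (S.B.flip μ) := fun _ => rfl
  have hR : ∀ (μ : Q) (q : P), ⟪R μ, q⟫ = S.B q μ := by
    intro μ q
    rw [hR0, InnerProductSpace.toDual_symm_apply]
    rfl
  have hRn : ∀ μ, ‖R μ‖ = ‖S.B.flip μ‖ := fun μ => by
    rw [hR0, LinearIsometryEquiv.norm_map]
  let a : Q →L[ℝ] Q →L[ℝ] ℝ := ((innerSL ℝ).comp R).flip.comp R |>.flip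
  have ha : ∀ μ ν, a μ ν = ⟪R μ, R ν⟫ := fun μ ν => rfl
  have hc : IsCoercive a := by
    refine ⟨β * β, by positivity, fun μ => ?_⟩
    rw [ha, real_inner_self_eq_norm_mul_norm, hRn]
    nlinarith [key μ, norm_nonneg μ, mul_nonneg hβ.le (norm_nonneg μ)]
  let e := hc.continuousLinearEquivOfBilin
  let μ : Q := e.symm ((InnerProductSpace.toDual ℝ Q).symm y)
  have hμ : ∀ ν, a μ ν = y ν := by
    intro ν
    rw [← hc.continuousLinearEquivOfBilin_apply μ ν]
    simp [μ, e]
  refine ⟨R μ, ?_, ?_⟩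
  · rw [Submodule.mem_orthogonal']
    intro x hx
    have hx' : S.B x = 0 := hx
    rw [hR, hx']
    rfl
  · ext ν
    rw [← hR ν (R μ), real_inner_comm, ← ha, hμ]

/-- The right inverse `B⁻ : Q* → P` of `B`: `B⁻ y` is the unique `q` in the orthogonal complement
of `P_ker` with `B q = y`. -/
def Bminus (y : StrongDual ℝ Q) : P := (S.exists_lift y).choose

/-- The restriction `P* → P_ker*` of functionals to test functions in `P_ker`. -/
def restrictKer (F : StrongDual ℝ P) : StrongDual ℝ S.Pker := F.comp S.Pker.subtypeL

/-- `(p, m, lam)` is a weak solution on `(0,T)` of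
```
p' + A p - K* m + B* lam = g   in P*,
     K p + D m           = r   in M*,
     B p                 = h   in Q*,        p(0) = x,
```
with `p ∈ L²(0,T;P) ∩ C([0,T],H)`, `m ∈ L²(0,T;M)` and a `Q`-valued distribution `lam` on `(0,T)`.
The first equation holds in the sense of `P*`-valued distributions, the other two hold almost
everywhere. -/
structure IsWeakSolution (T : ℝ) (g : ℝ → StrongDual ℝ P) (r : ℝ → StrongDual ℝ M)
    (h : ℝ → StrongDual ℝ Q) (x : H) (p : ℝ → P) (m : ℝ → M)
    (lam : 𝓓'(timeInterval T, Q)) : Prop where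
  memL2_p : MemL2 T p
  memL2_m : MemL2 T m
  initial : HasInitialValue T (fun t => S.emb (p t)) x
  eq_p : ∀ φ : 𝓓(timeInterval T, ℝ),
    -(∫ t, deriv φ t • S.embDual (S.emb (p t)) ∂(timeMeasure T))
      + ∫ t, φ t • (S.AP (p t) - S.Kdual (m t)) ∂(timeMeasure T)
      + S.Bdual (lam φ)
    = ∫ t, φ t • g t ∂(timeMeasure T)
  eq_m : ∀ᵐ t ∂(timeMeasure T), S.K (p t) + S.D (m t) = r t
  eq_lam : ∀ᵐ t ∂(timeMeasure T), S.B (p t) = h t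

/-- The compatibility condition on the data: there is `w ∈ H_ker` with
`(w, q)_H = ⟨g(0) - (L + A) p⁰ - B⁻ h'(0) + K* D⁻¹ f(0), q⟩` for all `q ∈ P_ker`.
Here `g(0)` is the initial value of `g` as a function with values in `P_ker*`. -/
def Compatible (T : ℝ) (f : ℝ → StrongDual ℝ M) (g : ℝ → StrongDual ℝ P)
    (h : ℝ → StrongDual ℝ Q) (p0 : P) : Prop :=
  ∃ w ∈ S.Hker, ∀ q : S.Pker,
    ⟪w, S.emb q⟫ = initialValue T (fun t => S.restrictKer (g t)) q
      - (S.L p0 + S.AP p0) q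
      - S.embDual (S.emb (S.Bminus (initialValue T (weakDeriv T h)))) q
      + S.Kdual (S.Dinv (initialValue T f)) q

end ConstrainedSystem

end

set_option linter.unusedSectionVars false

noncomputable section

/-! ### Primitives and weak derivatives in time -/

section Primitive

open Filter Topology

variable {X Y : Type*} [NormedAddCommGroup X] [NormedSpace ℝ X] [NormedAddCommGroup Y]
  [NormedSpace ℝ Y]

/-! Eliminating unknowns reduces the system to one parabolic equation on `P_ker`. The second
equation gives `m = D⁻¹(r - K p)`, the constraint fixes `p` up to `P_ker`, and testing with `P_ker`
removes `B* λ`. What remains has the operator `A + L`. Here `L` is coercive on `P_ker`, because `D`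
is elliptic and `K` is bounded below there, while `A` is bounded on `H`; a Gårding inequality
follows (`exists_kerOp_garding`). The multiplier is recovered afterwards: the residual of the first
equation vanishes on `P_ker`, and by the inf-sup condition such functionals lie in the range of the
injective map `B*` (`Bdual_multiplier`).

The parabolic equation is treated in time-integrated form, with elements of the dual identified by
Riesz. For uniqueness, one more integration makes a difference of solutions `C¹` in time, so the
energy argument is classical (`Garding.ae_eq_zero`). For existence, an energy estimate bounds smooth
curves by the data they generate (`exists_energy_bound`). These data are dense because anything
orthogonal to them solves a homogeneous backward problem (`eq_zero_of_orthogonal_curveData`), so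
limits of curves give all solutions (`Garding.exists_solution`).

The corrector needs `m₀'` in `L²`. The reduced limit equation is formally differentiated in time,
and the compatibility condition says exactly that the initial value of the derivative is an element
of `H_ker`. Solving for the derivative and integrating gives a limit solution with `p` in
`H¹(0,T;P)`, hence `m` in `H¹(0,T;M)` (`exists_regular_solution`). By uniqueness every limit
solution has this regularity. The corrector is then the same system with `L²` data in the second
equation and zero data elsewhere (`exists_homogeneous_solution`). -/

instance (T : ℝ) : IsFiniteMeasure (timeMeasure T) := by
  unfold timeMeasure; infer_instance

instance (T : ℝ) : NullSingletonClass (timeMeasure T) := by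
  unfold timeMeasure; infer_instance

theorem ae_timeMeasure_iff {T : ℝ} {p : ℝ → Prop} :
    (∀ᵐ t ∂(timeMeasure T), p t) ↔ ∀ᵐ t, t ∈ Ioo 0 T → p t :=
  ae_restrict_iff' measurableSet_Ioo

theorem ae_timeMeasure_mem (T : ℝ) : ∀ᵐ t ∂(timeMeasure T), t ∈ Ioo 0 T :=
  ae_restrict_mem measurableSet_Ioo

theorem MemL2.integrable {T : ℝ} {u : ℝ → X} (hu : MemL2 T u) : Integrable u (timeMeasure T) :=
  MemLp.integrable (by norm_num) hu

theorem integrable_timeMeasure_iff {T : ℝ} {u : ℝ → X} :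
    Integrable u (timeMeasure T) ↔ Integrable ((Ioo 0 T).indicator u) volume := by
  rw [integrable_indicator_iff measurableSet_Ioo]; rfl

theorem ContinuousOn.memL2 {T : ℝ} {u : ℝ → X} (hu : ContinuousOn u (Icc 0 T)) : MemL2 T u := by
  obtain ⟨C, hC⟩ := isCompact_Icc.exists_bound_of_continuousOn hu
  refine MemLp.of_bound ((hu.mono Ioo_subset_Icc_self).aestronglyMeasurable measurableSet_Ioo) C ?_
  filter_upwards [ae_timeMeasure_mem T] with t ht using hC t (Ioo_subset_Icc_self ht)

theorem MemL2.clm {T : ℝ} {u : ℝ → X} (hu : MemL2 T u) (L : X →L[ℝ] Y) :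
    MemL2 T (fun t => L (u t)) :=
  L.comp_memLp' hu

/-- The primitive `t ↦ ∫₀ᵗ u` of a function on `(0,T)`. -/
def prim (T : ℝ) (u : ℝ → X) (t : ℝ) : X := ∫ s in (0 : ℝ)..t, u s ∂(timeMeasure T)

@[simp] theorem prim_at_zero (T : ℝ) (u : ℝ → X) : prim T u 0 = 0 := by simp [prim]

theorem prim_eq_indicator (T : ℝ) (u : ℝ → X) (t : ℝ) :
    prim T u t = ∫ s in (0 : ℝ)..t, (Ioo 0 T).indicator u s := by
  simp only [prim, intervalIntegral, timeMeasure]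
  rw [Measure.restrict_restrict measurableSet_Ioc, Measure.restrict_restrict measurableSet_Ioc,
    setIntegral_indicator measurableSet_Ioo, setIntegral_indicator measurableSet_Ioo]

theorem prim_eq_integral {T t : ℝ} (ht : t ∈ Icc 0 T) (u : ℝ → X) :
    prim T u t = ∫ s in (0 : ℝ)..t, u s := by
  rw [prim, intervalIntegral.integral_of_le ht.1, intervalIntegral.integral_of_le ht.1,
    timeMeasure, Measure.restrict_restrict measurableSet_Ioc, integral_Ioc_eq_integral_Ioo]
  refine setIntegral_congr_set ?_
  have h : (Ioc 0 t ∩ Ioo 0 T : Set ℝ) =ᵐ[volume] (Ioc 0 t ∩ Ioc 0 T : Set ℝ) :=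
    (EventuallyEq.refl (ae volume) (Ioc 0 t)).inter Ioo_ae_eq_Ioc
  refine h.trans ?_
  rw [inter_eq_left.2 (Ioc_subset_Ioc_right ht.2)]
  exact Ioo_ae_eq_Ioc.symm

theorem prim_at_end {T : ℝ} (hT : 0 ≤ T) (u : ℝ → X) : prim T u T = ∫ t, u t ∂(timeMeasure T) := by
  rw [prim_eq_integral ⟨hT, le_rfl⟩, intervalIntegral.integral_of_le hT,
    integral_Ioc_eq_integral_Ioo, timeMeasure]

theorem prim_congr {T : ℝ} {u v : ℝ → X} (h : u =ᵐ[timeMeasure T] v) : prim T u = prim T v := by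
  funext t
  refine intervalIntegral.integral_congr_ae ?_
  filter_upwards [h] with s hs _ using hs

theorem continuous_prim {T : ℝ} {u : ℝ → X} (hu : Integrable u (timeMeasure T)) :
    Continuous (prim T u) :=
  hu.continuous_primitive 0

theorem prim_add {T : ℝ} {u v : ℝ → X} (hu : Integrable u (timeMeasure T))
    (hv : Integrable v (timeMeasure T)) (t : ℝ) :
    prim T (fun t => u t + v t) t = prim T u t + prim T v t :=
  intervalIntegral.integral_add hu.intervalIntegrable hv.intervalIntegrable

theorem prim_sub {T : ℝ} {u v : ℝ → X} (hu : Integrable u (timeMeasure T))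
    (hv : Integrable v (timeMeasure T)) (t : ℝ) :
    prim T (fun t => u t - v t) t = prim T u t - prim T v t :=
  intervalIntegral.integral_sub hu.intervalIntegrable hv.intervalIntegrable

theorem prim_neg {T : ℝ} (u : ℝ → X) (t : ℝ) :
    prim T (fun t => - u t) t = - prim T u t :=
  intervalIntegral.integral_neg

variable [CompleteSpace X] [CompleteSpace Y]

theorem prim_clm {T : ℝ} {u : ℝ → X} (hu : Integrable u (timeMeasure T)) (L : X →L[ℝ] Y) (t : ℝ) :
    prim T (fun t => L (u t)) t = L (prim T u t) :=
  L.intervalIntegral_comp_comm hu.intervalIntegrable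

theorem ae_hasDerivAt_prim {T : ℝ} {u : ℝ → X} (hu : Integrable u (timeMeasure T)) :
    ∀ᵐ t ∂(timeMeasure T), HasDerivAt (prim T u) (u t) t := by
  have h := LocallyIntegrable.ae_hasDerivAt_integral
    (integrable_timeMeasure_iff.1 hu).locallyIntegrable
  rw [ae_timeMeasure_iff]
  filter_upwards [h] with t ht htm
  have := ht 0
  rw [indicator_of_mem htm] at this
  convert! this using 2
  exact prim_eq_indicator T u _

theorem hasDerivAt_prim_of_continuousOn {T t : ℝ} {u : ℝ → X} (hu : Continuous u)
    (ht : t ∈ Ioo 0 T) : HasDerivAt (prim T u) (u t) t := by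
  have h := intervalIntegral.integral_hasDerivAt_right (a := 0) (hu.intervalIntegrable 0 t)
    (hu.stronglyMeasurableAtFilter _ _) hu.continuousAt
  refine h.congr_of_eventuallyEq ?_
  filter_upwards [isOpen_Ioo.mem_nhds ht] with s hs
    using prim_eq_integral (Ioo_subset_Icc_self hs) u

/-- Integration by parts for absolutely continuous functions. The boundary term at `T` is kept
because the density argument uses a `φ` that need not vanish there. -/
theorem integral_deriv_mul_prim {T : ℝ} (hT : 0 ≤ T) {u : ℝ → ℝ}
    (hu : Integrable u (timeMeasure T)) {φ : ℝ → ℝ} (hφ : ContDiff ℝ 1 φ) :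
    ∫ t, deriv φ t * prim T u t ∂(timeMeasure T)
      = φ T * prim T u T - ∫ t, φ t * u t ∂(timeMeasure T) := by
  have hU : AbsolutelyContinuousOnInterval (prim T u) 0 T := by
    rw [funext (prim_eq_indicator T u)]
    exact (integrable_timeMeasure_iff.1 hu).intervalIntegrable
      |>.absolutelyContinuousOnInterval_intervalIntegral (by simp)
  have hΦ : AbsolutelyContinuousOnInterval φ 0 T := hφ.contDiffOn.absolutelyContinuousOnInterval
  have h := AbsolutelyContinuousOnInterval.integral_mul_deriv_eq_deriv_mul hΦ hU
  have e : ∀ f : ℝ → ℝ, ∫ t in (0 : ℝ)..T, f t = ∫ t, f t ∂(timeMeasure T) := fun f => by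
    rw [← prim_at_end hT, prim_eq_integral ⟨hT, le_rfl⟩]
  rw [e, e] at h
  have h2 : ∫ t, φ t * deriv (prim T u) t ∂(timeMeasure T)
      = ∫ t, φ t * u t ∂(timeMeasure T) := by
    refine integral_congr_ae ?_
    filter_upwards [ae_hasDerivAt_prim hu] with t ht
    rw [ht.deriv]
  rw [h2] at h
  simp at h
  linarith

theorem integral_deriv_smul_prim {T : ℝ} (hT : 0 ≤ T) {u : ℝ → X}
    (hu : Integrable u (timeMeasure T)) {φ : ℝ → ℝ} (hφ : ContDiff ℝ 1 φ) :
    ∫ t, deriv φ t • prim T u t ∂(timeMeasure T)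
      = φ T • prim T u T - ∫ t, φ t • u t ∂(timeMeasure T) := by
  have hc : Continuous φ := hφ.continuous
  have hd : Continuous (deriv φ) := hφ.continuous_deriv le_rfl
  have i1 : Integrable (fun t => deriv φ t • prim T u t) (timeMeasure T) :=
    MemL2.integrable (hd.smul (continuous_prim hu)).continuousOn.memL2
  have i2 : Integrable (fun t => φ t • u t) (timeMeasure T) := by
    obtain ⟨C, hC⟩ := isCompact_Icc.exists_bound_of_continuousOn (hc.continuousOn (s := Icc 0 T))
    refine hu.bdd_smul C hc.aestronglyMeasurable ?_
    filter_upwards [ae_timeMeasure_mem T] with t ht using hC t (Ioo_subset_Icc_self ht)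
  -- Continuous functionals separate points, which reduces the identity to the scalar one.
  refine (SeparatingDual.eq_iff_forall_dual_eq (R := ℝ)).2 fun ℓ => ?_
  rw [map_sub, map_smul, ← ℓ.integral_comp_comm i1, ← ℓ.integral_comp_comm i2]
  simp only [map_smul, ← prim_clm hu ℓ, smul_eq_mul]
  exact integral_deriv_mul_prim hT (ℓ.integrable_comp hu) hφ

end Primitive
end

/-! ### Test functions, weak derivatives and primitives -/

noncomputable section

section WeakDerivative

open Filter Topology

variable {X Y : Type*} [NormedAddCommGroup X] [NormedSpace ℝ X] [NormedAddCommGroup Y]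
  [NormedSpace ℝ Y]

/-- A smooth function with compact support in `(0,T)`, as a test function. -/
def mkTest {T : ℝ} (φ : ℝ → ℝ) (h1 : ContDiff ℝ (⊤ : ℕ∞) φ) (h2 : HasCompactSupport φ)
    (h3 : tsupport φ ⊆ Ioo 0 T) : 𝓓(timeInterval T, ℝ) :=
  ⟨φ, h1, h2, h3⟩

theorem testFunction_deriv_continuous {T : ℝ} (φ : 𝓓(timeInterval T, ℝ)) :
    Continuous (deriv φ) :=
  φ.contDiff.continuous_deriv (by simp)

theorem testFunction_contDiff_one {T : ℝ} (φ : 𝓓(timeInterval T, ℝ)) :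
    ContDiff ℝ 1 φ :=
  φ.contDiff.of_le (by simp)

theorem testFunction_eq_zero {T t : ℝ} (φ : 𝓓(timeInterval T, ℝ)) (ht : t ∉ Ioo 0 T) :
    φ t = 0 := by
  by_contra h
  exact ht (φ.tsupport_subset (subset_tsupport _ h))

theorem Continuous.integrable_smul_timeMeasure {T : ℝ} {φ : ℝ → ℝ} (hc : Continuous φ) {u : ℝ → X}
    (hu : Integrable u (timeMeasure T)) : Integrable (fun t => φ t • u t) (timeMeasure T) := by
  obtain ⟨C, hC⟩ := isCompact_Icc.exists_bound_of_continuousOn (hc.continuousOn (s := Icc 0 T))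
  refine hu.bdd_smul C hc.aestronglyMeasurable ?_
  filter_upwards [ae_timeMeasure_mem T] with t ht using hC t (Ioo_subset_Icc_self ht)

theorem ae_eq_of_forall_test [CompleteSpace X] {T : ℝ} {u v : ℝ → X}
    (hu : LocallyIntegrableOn u (Ioo 0 T) volume) (hv : LocallyIntegrableOn v (Ioo 0 T) volume)
    (h : ∀ φ : 𝓓(timeInterval T, ℝ),
      ∫ t, φ t • u t ∂(timeMeasure T) = ∫ t, φ t • v t ∂(timeMeasure T)) :
    u =ᵐ[timeMeasure T] v := by
  have := isOpen_Ioo.ae_eq_zero_of_integral_contDiff_smul_eq_zero (hu.sub hv)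
    (fun φ h1 h2 h3 => ?_)
  · rw [EventuallyEq, ae_timeMeasure_iff]
    filter_upwards [this] with t ht htm using sub_eq_zero.1 (ht htm)
  · have hφ := h (mkTest φ h1 h2 h3)
    have key : ∀ w : ℝ → X, LocallyIntegrableOn w (Ioo 0 T) volume →
        Integrable (fun t => φ t • w t) volume := fun w hw =>
      TestFunction.integrable_bilin (Ω := timeInterval T) (ContinuousLinearMap.lsmul ℝ ℝ) hw
        (mkTest φ h1 h2 h3)
    have key2 : ∀ w : ℝ → X, ∫ t, φ t • w t ∂(timeMeasure T) = ∫ t, φ t • w t := fun w => by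
      refine setIntegral_eq_integral_of_forall_compl_eq_zero fun t ht => ?_
      rw [show φ t = 0 from testFunction_eq_zero (mkTest φ h1 h2 h3) ht, zero_smul]
    change ∫ t, φ t • u t ∂(timeMeasure T) = ∫ t, φ t • v t ∂(timeMeasure T) at hφ
    rw [key2, key2] at hφ
    simp only [Pi.sub_apply, smul_sub]
    rw [integral_sub (key u hu) (key v hv), hφ, sub_self]

theorem MeasureTheory.Integrable.locallyIntegrableOn_Ioo {T : ℝ} {u : ℝ → X}
    (hu : Integrable u (timeMeasure T)) : LocallyIntegrableOn u (Ioo 0 T) volume :=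
  IntegrableOn.locallyIntegrableOn hu

theorem integral_deriv_testFunction {T : ℝ} (hT : 0 ≤ T) (φ : 𝓓(timeInterval T, ℝ)) :
    ∫ t, deriv φ t ∂(timeMeasure T) = 0 := by
  rw [← prim_at_end hT, prim_eq_integral ⟨hT, le_rfl⟩]
  rw [intervalIntegral.integral_deriv_eq_sub
    (fun t _ => ((testFunction_contDiff_one φ).differentiable one_ne_zero).differentiableAt)
    ((testFunction_deriv_continuous φ).intervalIntegrable _ _)]
  rw [testFunction_eq_zero φ (by simp), testFunction_eq_zero φ (by simp), sub_self]

/-- The primitive from `0` vanishes to the left of the support of `χ`, and to its right because the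
total integral is zero. It is therefore again compactly supported in `(0,T)`. -/
theorem exists_testFunction_deriv_eq {T : ℝ} (χ : 𝓓(timeInterval T, ℝ))
    (hχ : ∫ t, χ t = 0) : ∃ φ : 𝓓(timeInterval T, ℝ), ∀ t, deriv φ t = χ t := by
  by_cases hne : (tsupport χ).Nonempty
  swap
  · refine ⟨0, fun t => ?_⟩
    have : χ t = 0 := by
      by_contra h
      exact hne ⟨t, subset_tsupport _ h⟩
    rw [this]
    exact (hasDerivAt_const t (0 : ℝ)).deriv
  have hK : IsCompact (tsupport χ) := χ.hasCompactSupport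
  obtain ⟨a, haK, ha⟩ := hK.exists_isLeast hne
  obtain ⟨b, hbK, hb⟩ := hK.exists_isGreatest hne
  have ha0 : 0 < a := (χ.tsupport_subset haK).1
  have hbT : b < T := (χ.tsupport_subset hbK).2
  have hz : ∀ t, t ∉ Icc a b → χ t = 0 := fun t ht => by
    by_contra h
    exact ht ⟨ha (subset_tsupport _ h), hb (subset_tsupport _ h)⟩
  have hd : ∀ t, HasDerivAt (fun t => ∫ s in (0 : ℝ)..t, χ s) (χ t) t := fun t =>
    intervalIntegral.integral_hasDerivAt_right (χ.continuous.intervalIntegrable 0 t)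
      (χ.continuous.stronglyMeasurableAtFilter _ _) χ.continuous.continuousAt
  have hsupp : Function.support (fun t => ∫ s in (0 : ℝ)..t, χ s) ⊆ Icc a b := by
    intro t ht
    by_contra hab
    apply ht
    rw [mem_Icc, not_and_or, not_le, not_le] at hab
    rcases hab with h | h
    · change ∫ s in (0 : ℝ)..t, χ s = 0
      rw [intervalIntegral.integral_congr (g := fun _ => 0), intervalIntegral.integral_zero]
      intro s hs
      refine hz s fun hs' => ?_
      have : s ≤ max 0 t := hs.2
      have := max_lt ha0 h
      linarith [hs'.1]
    · have hab' : a ≤ b := ha hbK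
      change ∫ s in (0 : ℝ)..t, χ s = 0
      rw [← hχ, intervalIntegral.integral_of_le (by linarith)]
      refine setIntegral_eq_integral_of_forall_compl_eq_zero fun s hs => hz s fun hs' => hs ?_
      exact ⟨by linarith [hs'.1], by linarith [hs'.2]⟩
  have hts : tsupport (fun t => ∫ s in (0 : ℝ)..t, χ s) ⊆ Icc a b :=
    closure_minimal hsupp isClosed_Icc
  refine ⟨mkTest (fun t => ∫ s in (0 : ℝ)..t, χ s) ?_ ?_ ?_, fun t => (hd t).deriv⟩
  · rw [contDiff_infty_iff_deriv]
    refine ⟨fun t => (hd t).differentiableAt, ?_⟩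
    rw [funext fun t => (hd t).deriv]
    exact χ.contDiff
  · exact HasCompactSupport.of_support_subset_isCompact isCompact_Icc hsupp
  · exact hts.trans fun t ht => ⟨by linarith [ht.1], by linarith [ht.2]⟩

theorem exists_testFunction_integral_eq_one {T : ℝ} (hT : 0 < T) :
    ∃ ρ : 𝓓(timeInterval T, ℝ), ∫ t, ρ t = 1 := by
  let b : ContDiffBump (T / 2) := ⟨T / 8, T / 4, by positivity, by linarith⟩
  refine ⟨mkTest (b.normed volume) b.contDiff_normed b.hasCompactSupport_normed ?_,
    b.integral_normed⟩
  rw [b.tsupport_normed_eq, Real.closedBall_eq_Icc]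
  intro t ht
  have h1 : T / 2 - T / 4 ≤ t := ht.1
  have h2 : t ≤ T / 2 + T / 4 := ht.2
  exact ⟨by linarith, by linarith⟩

/-- Du Bois-Reymond: subtracting `(∫ ψ) ρ` from a test function `ψ`, with `∫ ρ = 1`, leaves a
derivative of a test function. Hence `u` acts on `ψ` like the constant `∫ ρ u`. -/
theorem ae_eq_const_of_forall_deriv [CompleteSpace X] {T : ℝ} (hT : 0 < T) {u : ℝ → X}
    (hu : Integrable u (timeMeasure T))
    (h : ∀ φ : 𝓓(timeInterval T, ℝ), ∫ t, deriv φ t • u t ∂(timeMeasure T) = 0) :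
    ∃ c : X, u =ᵐ[timeMeasure T] fun _ => c := by
  obtain ⟨ρ, hρ⟩ := exists_testFunction_integral_eq_one hT
  have hρi : Integrable ρ volume := ρ.continuous.integrable_of_hasCompactSupport ρ.hasCompactSupport
  refine ⟨∫ t, ρ t • u t ∂(timeMeasure T), ae_eq_of_forall_test hu.locallyIntegrableOn_Ioo
    (integrable_const _).locallyIntegrableOn_Ioo fun ψ => ?_⟩
  have hψi : Integrable ψ volume := ψ.continuous.integrable_of_hasCompactSupport ψ.hasCompactSupport
  obtain ⟨φ, hφ⟩ := exists_testFunction_deriv_eq (ψ - (∫ t, ψ t) • ρ) (by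
    have : ∀ t, (ψ - (∫ t, ψ t) • ρ) t = ψ t - (∫ t, ψ t) * ρ t := fun t => rfl
    simp only [this]
    rw [integral_sub hψi (hρi.const_mul _), integral_const_mul, hρ, mul_one, sub_self])
  have h0 := h φ
  have e : ∀ t, deriv φ t • u t = ψ t • u t - (∫ t, ψ t) • (ρ t • u t) := fun t => by
    rw [hφ, smul_smul, ← sub_smul]; rfl
  simp only [e] at h0
  have hi : Integrable (fun t => (∫ t, ψ t) • (ρ t • u t)) (timeMeasure T) :=
    (ρ.continuous.integrable_smul_timeMeasure hu).smul (∫ t, ψ t)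
  rw [integral_sub (ψ.continuous.integrable_smul_timeMeasure hu) hi, integral_smul,
    sub_eq_zero] at h0
  rw [h0, integral_smul_const]
  congr 1
  refine (setIntegral_eq_integral_of_forall_compl_eq_zero fun t ht => ?_).symm
  exact testFunction_eq_zero ψ ht

variable [CompleteSpace X] [CompleteSpace Y]

theorem HasWeakDeriv.ae_eq_prim {T : ℝ} (hT : 0 < T) {u v : ℝ → X} (h : HasWeakDeriv T u v)
    (hu : Integrable u (timeMeasure T)) (hv : Integrable v (timeMeasure T)) :
    ∃ c : X, u =ᵐ[timeMeasure T] fun t => c + prim T v t := by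
  have hp : Integrable (prim T v) (timeMeasure T) :=
    (continuous_prim hv).continuousOn.memL2.integrable
  obtain ⟨c, hc⟩ := ae_eq_const_of_forall_deriv hT (hu.sub hp) fun φ => by
    have hd := testFunction_deriv_continuous φ
    simp only [Pi.sub_apply, smul_sub]
    rw [integral_sub (hd.integrable_smul_timeMeasure hu) (hd.integrable_smul_timeMeasure hp),
      h.integral_eq, integral_deriv_smul_prim hT.le hv (testFunction_contDiff_one φ),
      testFunction_eq_zero φ (by simp)]
    simp
  refine ⟨c, ?_⟩
  filter_upwards [hc] with t ht
  rw [← ht]; simp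

theorem hasWeakDeriv_of_ae_eq {T : ℝ} (hT : 0 < T) {u v : ℝ → X} {c : X}
    (hv : Integrable v (timeMeasure T)) (h : u =ᵐ[timeMeasure T] fun t => c + prim T v t) :
    HasWeakDeriv T u v := by
  have hp : Integrable (prim T v) (timeMeasure T) :=
    (continuous_prim hv).continuousOn.memL2.integrable
  refine ⟨(((integrable_const c).add hp).congr h.symm).locallyIntegrableOn_Ioo,
    hv.locallyIntegrableOn_Ioo, fun φ => ?_⟩
  have hd := testFunction_deriv_continuous φ
  have e : ∫ t, deriv φ t • u t ∂(timeMeasure T)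
      = ∫ t, (deriv φ t • c + deriv φ t • prim T v t) ∂(timeMeasure T) := by
    refine integral_congr_ae ?_
    filter_upwards [h] with t ht
    rw [ht, smul_add]
  rw [e, integral_add (hd.integrable_smul_timeMeasure (integrable_const c))
    (hd.integrable_smul_timeMeasure hp), integral_smul_const, integral_deriv_testFunction hT.le,
    integral_deriv_smul_prim hT.le hv (testFunction_contDiff_one φ),
    testFunction_eq_zero φ (by simp)]
  simp

theorem HasWeakDeriv.ae_unique {T : ℝ} {u v w : ℝ → X} (h : HasWeakDeriv T u v)
    (h' : HasWeakDeriv T u w) : v =ᵐ[timeMeasure T] w :=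
  ae_eq_of_forall_test h.locallyIntegrable_right h'.locallyIntegrable_right fun φ =>
    neg_injective ((h.integral_eq φ).symm.trans (h'.integral_eq φ))

theorem HasWeakDeriv.weakDeriv_ae_eq {T : ℝ} {u v : ℝ → X} (h : HasWeakDeriv T u v) :
    weakDeriv T u =ᵐ[timeMeasure T] v := by
  have hu : ∃ v, HasWeakDeriv T u v := ⟨v, h⟩
  rw [weakDeriv, dif_pos hu]
  exact hu.choose_spec.ae_unique h

theorem HasInitialValue.unique {T : ℝ} (hT : 0 < T) {u : ℝ → X} {x y : X}
    (hx : HasInitialValue T u x) (hy : HasInitialValue T u y) : x = y := by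
  obtain ⟨w, hw, huw, rfl⟩ := hx
  obtain ⟨z, hz, huz, rfl⟩ := hy
  have : w =ᵐ[volume.restrict (Icc 0 T)] z := by
    rw [restrict_Ioo_eq_restrict_Icc.symm]
    exact huw.symm.trans huz
  exact Measure.eqOn_Icc_of_ae_eq volume hT.ne this hw hz ⟨le_rfl, hT.le⟩

theorem HasInitialValue.congr {T : ℝ} {u v : ℝ → X} {x : X}
    (hx : HasInitialValue T u x) (h : u =ᵐ[timeMeasure T] v) : HasInitialValue T v x := by
  obtain ⟨w, hw, huw, rfl⟩ := hx
  exact ⟨w, hw, h.symm.trans huw, rfl⟩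

theorem HasInitialValue.initialValue_eq {T : ℝ} (hT : 0 < T) {u : ℝ → X} {x : X}
    (hx : HasInitialValue T u x) : initialValue T u = x := by
  have hu : ∃ x, HasInitialValue T u x := ⟨x, hx⟩
  rw [initialValue, dif_pos hu]
  exact hu.choose_spec.unique hT hx

theorem hasInitialValue_of_ae_eq {T : ℝ} {u v : ℝ → X} {c : X}
    (hv : Integrable v (timeMeasure T)) (h : u =ᵐ[timeMeasure T] fun t => c + prim T v t) :
    HasInitialValue T u c :=
  ⟨_, (continuous_const.add (continuous_prim hv)).continuousOn, h, by simp⟩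

/-- `u(t) = c + ∫₀ᵗ v` with `v ∈ L²(0,T;X)`. -/
structure IsPrim (T : ℝ) (u : ℝ → X) (c : X) (v : ℝ → X) : Prop where
  memL2 : MemL2 T v
  ae_eq : u =ᵐ[timeMeasure T] fun t => c + prim T v t

namespace IsPrim

variable {T : ℝ} {u u' v v' : ℝ → X} {c c' : X}

theorem hasWeakDeriv (h : IsPrim T u c v) (hT : 0 < T) : HasWeakDeriv T u v :=
  hasWeakDeriv_of_ae_eq hT h.memL2.integrable h.ae_eq

theorem hasInitialValue (h : IsPrim T u c v) : HasInitialValue T u c :=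
  hasInitialValue_of_ae_eq h.memL2.integrable h.ae_eq

theorem memL2_left (h : IsPrim T u c v) : MemL2 T u :=
  (memLp_congr_ae h.ae_eq).2
    (continuous_const.add (continuous_prim h.memL2.integrable)).continuousOn.memL2

theorem memH1 (h : IsPrim T u c v) (hT : 0 < T) : MemH1 T u :=
  ⟨h.memL2_left, v, h.memL2, h.hasWeakDeriv hT⟩

theorem congr (h : IsPrim T u c v) (hu : u =ᵐ[timeMeasure T] u') : IsPrim T u' c v :=
  ⟨h.memL2, hu.symm.trans h.ae_eq⟩

theorem clm (h : IsPrim T u c v) (L : X →L[ℝ] Y) :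
    IsPrim T (fun t => L (u t)) (L c) (fun t => L (v t)) := by
  refine ⟨h.memL2.clm L, ?_⟩
  filter_upwards [h.ae_eq] with t ht
  rw [ht, map_add, prim_clm h.memL2.integrable]

theorem add (h : IsPrim T u c v) (h' : IsPrim T u' c' v') :
    IsPrim T (fun t => u t + u' t) (c + c') (fun t => v t + v' t) := by
  refine ⟨MemLp.add h.memL2 h'.memL2, ?_⟩
  filter_upwards [h.ae_eq, h'.ae_eq] with t ht ht'
  rw [ht, ht', prim_add h.memL2.integrable h'.memL2.integrable]
  abel

theorem sub (h : IsPrim T u c v) (h' : IsPrim T u' c' v') :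
    IsPrim T (fun t => u t - u' t) (c - c') (fun t => v t - v' t) := by
  refine ⟨MemLp.sub h.memL2 h'.memL2, ?_⟩
  filter_upwards [h.ae_eq, h'.ae_eq] with t ht ht'
  rw [ht, ht', prim_sub h.memL2.integrable h'.memL2.integrable]
  abel

theorem of_hasWeakDeriv (hT : 0 < T) (hu : MemL2 T u) (hv : MemL2 T v) (h : HasWeakDeriv T u v) :
    ∃ c, IsPrim T u c v := by
  obtain ⟨c, hc⟩ := h.ae_eq_prim hT hu.integrable hv.integrable
  exact ⟨c, hv, hc⟩

end IsPrim

end WeakDerivative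
end

/-! ### Uniqueness for abstract parabolic equations -/

noncomputable section

section ParabolicUniqueness

open Filter Topology ContinuousLinearMap

variable {V H : Type*} [NormedAddCommGroup V] [InnerProductSpace ℝ V] [CompleteSpace V]
  [NormedAddCommGroup H] [InnerProductSpace ℝ H] [CompleteSpace H]

/-- The Gårding inequality for an operator `a` on `V`, relative to an embedding `i : V → H`. -/
def Garding (i : V →L[ℝ] H) (a : V →L[ℝ] V) (α k : ℝ) : Prop :=
  ∀ v, α * ‖v‖ ^ 2 ≤ ⟪a v, v⟫ + k * ‖i v‖ ^ 2

theorem Garding.of_adjoint {i : V →L[ℝ] H} {a : V →L[ℝ] V} {α k : ℝ} (h : Garding i a α k) :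
    Garding i (adjoint a) α k := fun v => by
  rw [adjoint_inner_left, real_inner_comm]
  exact h v

theorem Garding.eq_zero_of_hasDerivAt {i : V →L[ℝ] H} {a : V →L[ℝ] V} {α k : ℝ}
    (h : Garding i a α k) (hα : 0 < α) {T : ℝ} {Z Y : ℝ → V}
    (hc : ContinuousOn Z (Icc 0 T)) (hd : ∀ t ∈ Ioo 0 T, HasDerivAt Z (Y t) t)
    (heq : ∀ t ∈ Ioo 0 T, adjoint i (i (Y t)) + a (Z t) = 0) (h0 : Z 0 = 0) :
    ∀ t ∈ Ioo 0 T, Z t = 0 := by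
  -- The weight cancels the term `k ‖i v‖²` of the Gårding inequality, so `f` is nonincreasing, and
  -- it starts at zero.
  let f : ℝ → ℝ := fun t => Real.exp (-(2 * k * t)) * ‖i (Z t)‖ ^ 2
  have key : ∀ t ∈ Ioo 0 T, ⟪i (Z t), i (Y t)⟫ = -⟪a (Z t), Z t⟫ := fun t ht => by
    have := congrArg (fun v => ⟪v, Z t⟫) (heq t ht)
    simp only [inner_add_left, adjoint_inner_left, inner_zero_left] at this
    rw [real_inner_comm]; linarith
  have hf : ∀ t ∈ Ioo 0 T, HasDerivAt f (Real.exp (-(2 * k * t)) * (-(2 * k)) * ‖i (Z t)‖ ^ 2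
      + Real.exp (-(2 * k * t)) * (2 * ⟪i (Z t), i (Y t)⟫)) t := fun t ht => by
    have h1 : HasDerivAt (fun t => i (Z t)) (i (Y t)) t := i.hasFDerivAt.comp_hasDerivAt t (hd t ht)
    have h2 : HasDerivAt (fun t : ℝ => -(2 * k * t)) (-(2 * k)) t := by
      simpa using (hasDerivAt_id t).const_mul (-(2 * k))
    exact h2.exp.mul h1.norm_sq
  have hanti : AntitoneOn f (Icc 0 T) := by
    refine antitoneOn_of_deriv_nonpos (convex_Icc 0 T) ?_ ?_ ?_
    · exact ContinuousOn.mul (by fun_prop) ((i.continuous.comp_continuousOn hc).norm.pow 2)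
    · rw [interior_Icc]
      exact fun t ht => (hf t ht).differentiableAt.differentiableWithinAt
    · rw [interior_Icc]
      intro t ht
      rw [(hf t ht).deriv, key t ht]
      have h1 := h (Z t)
      have h2 : 0 ≤ α * ‖Z t‖ ^ 2 := by positivity
      have h3 := Real.exp_pos (-(2 * k * t))
      have : Real.exp (-(2 * k * t)) * (-(2 * k)) * ‖i (Z t)‖ ^ 2
        + Real.exp (-(2 * k * t)) * (2 * -⟪a (Z t), Z t⟫)
        = -(2 * Real.exp (-(2 * k * t)) * (⟪a (Z t), Z t⟫ + k * ‖i (Z t)‖ ^ 2)) := by ring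
      rw [this, neg_nonpos]
      exact mul_nonneg (by positivity) (h2.trans h1)
  intro t ht
  have h1 : f t ≤ f 0 := hanti ⟨le_rfl, ht.1.le.trans ht.2.le⟩ (Ioo_subset_Icc_self ht) ht.1.le
  have h2 : f 0 = 0 := by simp [f, h0]
  rw [h2] at h1
  have h3 : ‖i (Z t)‖ ^ 2 = 0 := by
    refine le_antisymm ?_ (by positivity)
    exact nonpos_of_mul_nonpos_right h1 (Real.exp_pos _)
  have h4 : i (Z t) = 0 := by simpa using h3
  -- Here `i` need not be injective: `i (Z t) = 0` forces `⟪a (Z t), Z t⟫ = 0`, and the Gårding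
  -- inequality then gives `Z t = 0`.
  have h5 := key t ht
  rw [h4, inner_zero_left] at h5
  have h6 := h (Z t)
  rw [h3] at h6
  have h7 : ‖Z t‖ ^ 2 ≤ 0 := by
    by_contra hcon
    have := mul_pos hα (not_le.1 hcon)
    linarith
  have : ‖Z t‖ ^ 2 = 0 := le_antisymm h7 (by positivity)
  simpa using this

theorem ae_eq_zero_of_prim_eqOn_const {T : ℝ} {u : ℝ → V} (hu : Integrable u (timeMeasure T))
    {c : V} (h : ∀ t ∈ Ioo 0 T, prim T u t = c) : u =ᵐ[timeMeasure T] 0 := by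
  filter_upwards [ae_hasDerivAt_prim hu, ae_timeMeasure_mem T] with t ht htm
  refine ht.unique ((hasDerivAt_const t c).congr_of_eventuallyEq ?_)
  filter_upwards [isOpen_Ioo.mem_nhds htm] with s hs using h s hs

/-- Integrating the equation once more shows that the double primitive of `u` is a `C¹` solution of
the homogeneous problem. The energy argument applies to it without a product rule for weak
solutions, and differentiating twice returns to `u`. -/
theorem Garding.ae_eq_zero {i : V →L[ℝ] H} {a : V →L[ℝ] V} {α k : ℝ}
    (h : Garding i a α k) (hα : 0 < α) {T : ℝ} {u : ℝ → V} (hu : Integrable u (timeMeasure T))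
    (heq : ∀ᵐ t ∂(timeMeasure T), adjoint i (i (u t)) + a (prim T u t) = 0) :
    u =ᵐ[timeMeasure T] 0 := by
  have hp : Continuous (prim T u) := continuous_prim hu
  have hpi : Integrable (prim T u) (timeMeasure T) := hp.continuousOn.memL2.integrable
  have hd : ∀ t ∈ Ioo 0 T, HasDerivAt (prim T (prim T u)) (prim T u t) t := fun t ht =>
    hasDerivAt_prim_of_continuousOn hp ht
  have hz := h.eq_zero_of_hasDerivAt hα (continuous_prim hpi).continuousOn hd (fun t _ => by
    have e : prim T (fun t => adjoint i (i (u t)) + a (prim T u t)) t = 0 := by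
      rw [prim_congr (v := fun _ => (0 : V)) heq]
      simp [prim]
    rwa [prim_add (u := fun t => adjoint i (i (u t)))
      (((adjoint i).comp i).integrable_comp hu) (a.integrable_comp hpi),
      prim_clm hpi a, show prim T (fun t => adjoint i (i (u t))) t = adjoint i (i (prim T u t)) from
        prim_clm hu ((adjoint i).comp i) t] at e) (prim_at_zero _ _)
  refine ae_eq_zero_of_prim_eqOn_const hu (c := 0) fun t ht => ?_
  refine (hd t ht).unique ((hasDerivAt_const t 0).congr_of_eventuallyEq ?_)
  filter_upwards [isOpen_Ioo.mem_nhds ht] with s hs using hz s hs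

/-- With `W(t) = ∫ₜᵀ w`, the time-reversed function `Z(t) = ∫ W` over `[T - t, T]` is a classical
solution of the forward homogeneous problem starting at zero. -/
theorem Garding.ae_eq_zero_backward {i : V →L[ℝ] H} {a : V →L[ℝ] V} {α k : ℝ}
    (h : Garding i a α k) (hα : 0 < α) {T : ℝ} {w : ℝ → V}
    (hw : Integrable w (timeMeasure T))
    (heq : ∀ᵐ t ∂(timeMeasure T), adjoint i (i (w t)) + a (prim T w T - prim T w t) = 0) :
    w =ᵐ[timeMeasure T] 0 := by
  have hp : Continuous fun t => prim T w T - prim T w t :=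
    continuous_const.sub (continuous_prim hw)
  set W : ℝ → V := fun t => prim T w T - prim T w t with hW
  have hpi : Integrable W (timeMeasure T) := hp.continuousOn.memL2.integrable
  have hd : ∀ t ∈ Ioo 0 T, HasDerivAt (prim T W) (W t) t := fun t ht =>
    hasDerivAt_prim_of_continuousOn hp ht
  have hrefl : ∀ t ∈ Ioo 0 T, T - t ∈ Ioo 0 T := fun t ht => ⟨by linarith [ht.2], by linarith [ht.1]⟩
  have hz := h.eq_zero_of_hasDerivAt hα (T := T) (Z := fun t => prim T W T - prim T W (T - t))
    (Y := fun t => W (T - t))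
    (continuous_const.sub ((continuous_prim hpi).comp (by fun_prop))).continuousOn
    (fun t ht => by
      have h1 := (hd (T - t) (hrefl t ht)).scomp t ((hasDerivAt_id t).const_sub T)
      have h2 := h1.const_sub (prim T W T)
      simpa [Function.comp_def] using h2) (fun t ht => by
    have e : ∀ s, adjoint i (i (prim T w s)) + a (prim T W s) = 0 := fun s => by
      have e : prim T (fun t => adjoint i (i (w t)) + a (W t)) s = 0 := by
        rw [prim_congr (v := fun _ => (0 : V)) heq]
        simp [prim]
      rwa [prim_add (u := fun t => adjoint i (i (w t)))
        (((adjoint i).comp i).integrable_comp hw) (a.integrable_comp hpi),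
        prim_clm hpi a, show prim T (fun t => adjoint i (i (w t))) s
          = adjoint i (i (prim T w s)) from prim_clm hw ((adjoint i).comp i) s] at e
    -- Subtracting the integrated equations at `T` and at `T - t` leaves the equation on `[T - t,
    -- T]`.
    have e1 := e T
    have e2 := e (T - t)
    simp only [hW, map_sub] at e1 e2 ⊢
    rw [← sub_eq_zero.2 (e1.trans e2.symm)]
    abel) (by simp)
  have hz' : ∀ t ∈ Ioo 0 T, prim T W t = prim T W T := fun t ht => by
    have := hz (T - t) (hrefl t ht)
    simp only [sub_sub_cancel] at this
    exact (sub_eq_zero.1 this).symm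
  refine ae_eq_zero_of_prim_eqOn_const hw (c := prim T w T) fun t ht => ?_
  have : W t = 0 := by
    refine (hd t ht).unique ((hasDerivAt_const t (prim T W T)).congr_of_eventuallyEq ?_)
    filter_upwards [isOpen_Ioo.mem_nhds ht] with s hs using hz' s hs
  exact (sub_eq_zero.1 this).symm

end ParabolicUniqueness
end

/-! ### Energy estimate and density of the attainable data -/

noncomputable section

section ParabolicExistence

open Filter Topology ContinuousLinearMap

variable {V H : Type*} [NormedAddCommGroup V] [InnerProductSpace ℝ V] [CompleteSpace V]
  [NormedAddCommGroup H] [InnerProductSpace ℝ H] [CompleteSpace H]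

/-- The curve `t ↦ x + ∫₀ᵗ v` attached to `(x, v)` with `v` continuous, as a linear map. -/
def curve : V × C(ℝ, V) →ₗ[ℝ] C(ℝ, V) where
  toFun x := ⟨fun t => x.1 + ∫ s in (0 : ℝ)..t, x.2 s,
    continuous_const.add (intervalIntegral.continuous_primitive
      (fun _ _ => x.2.continuous.intervalIntegrable _ _) 0)⟩
  map_add' x y := by
    ext t
    simp only [Prod.fst_add, Prod.snd_add, ContinuousMap.add_apply, ContinuousMap.coe_mk]
    rw [intervalIntegral.integral_add (x.2.continuous.intervalIntegrable _ _)
      (y.2.continuous.intervalIntegrable _ _)]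
    abel
  map_smul' c x := by
    ext t
    simp [smul_add]

theorem curve_apply (x : V × C(ℝ, V)) (t : ℝ) : curve x t = x.1 + ∫ s in (0 : ℝ)..t, x.2 s := rfl

theorem curve_zero (x : V × C(ℝ, V)) : curve x 0 = x.1 := by simp [curve_apply]

theorem hasDerivAt_curve (x : V × C(ℝ, V)) (t : ℝ) : HasDerivAt (curve x) (x.2 t) t := by
  have h := intervalIntegral.integral_hasDerivAt_right (a := 0)
    (x.2.continuous.intervalIntegrable 0 t)
    (x.2.continuous.stronglyMeasurableAtFilter _ _) x.2.continuous.continuousAt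
  exact h.const_add x.1

/-- The right-hand side `i* i u' + a u` generated by the curve `u` attached to `(x, v)`. -/
def curveRhs (i : V →L[ℝ] H) (a : V →L[ℝ] V) : V × C(ℝ, V) →ₗ[ℝ] C(ℝ, V) where
  toFun x := ⟨fun t => adjoint i (i (x.2 t)) + a (curve x t), by fun_prop⟩
  map_add' x y := by
    ext t
    simp only [Prod.snd_add, map_add, ContinuousMap.add_apply, ContinuousMap.coe_mk]
    abel
  map_smul' c x := by
    ext t
    simp [smul_add]

theorem curveRhs_apply (i : V →L[ℝ] H) (a : V →L[ℝ] V) (x : V × C(ℝ, V)) (t : ℝ) :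
    curveRhs i a x t = adjoint i (i (x.2 t)) + a (curve x t) := rfl

/-- A continuous function, as an element of `L²(0,T;V)`. -/
def contToLp (T : ℝ) : C(ℝ, V) →ₗ[ℝ] Lp V 2 (timeMeasure T) where
  toFun f := MemLp.toLp f (f.continuous.continuousOn.memL2)
  map_add' _ _ := rfl
  map_smul' _ _ := rfl

theorem coeFn_contToLp (T : ℝ) (f : C(ℝ, V)) : contToLp T f =ᵐ[timeMeasure T] f :=
  MemLp.coeFn_toLp f.continuous.continuousOn.memL2

theorem norm_sq_Lp {T : ℝ} (f : Lp V 2 (timeMeasure T)) :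
    ‖f‖ ^ 2 = ∫ t, ‖f t‖ ^ 2 ∂(timeMeasure T) := by
  rw [← real_inner_self_eq_norm_sq, L2.inner_def]
  simp

theorem norm_sq_contToLp (T : ℝ) (f : C(ℝ, V)) :
    ‖contToLp T f‖ ^ 2 = ∫ t, ‖f t‖ ^ 2 ∂(timeMeasure T) := by
  rw [norm_sq_Lp]
  refine integral_congr_ae ?_
  filter_upwards [coeFn_contToLp T f] with t ht
  rw [ht]

/-- With `F = curveRhs i a x`, Young's inequality `2 ‖F‖ ‖u‖ ≤ α ‖u‖² + ‖F‖² / α` uses up half of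
the coercive term `2 α ‖u‖²`; the other half stays on the left. The left side minus the right side
is then nonincreasing in time. -/
theorem energy_estimate {i : V →L[ℝ] H} {a : V →L[ℝ] V} {α k : ℝ}
    (h : Garding i a α k) (hα : 0 < α) (x : V × C(ℝ, V)) {t : ℝ} (ht : 0 ≤ t) :
    Real.exp (-(2 * k * t)) * ‖i (curve x t)‖ ^ 2
      + ∫ s in (0 : ℝ)..t, Real.exp (-(2 * k * s)) * (α * ‖curve x s‖ ^ 2)
    ≤ ‖i x.1‖ ^ 2
      + ∫ s in (0 : ℝ)..t, Real.exp (-(2 * k * s)) * (‖curveRhs i a x s‖ ^ 2 / α) := by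
  have c1 : Continuous fun s => Real.exp (-(2 * k * s)) * (α * ‖curve x s‖ ^ 2) := by fun_prop
  have c2 : Continuous fun s => Real.exp (-(2 * k * s)) * (‖curveRhs i a x s‖ ^ 2 / α) := by
    fun_prop
  let G : ℝ → ℝ := fun t => Real.exp (-(2 * k * t)) * ‖i (curve x t)‖ ^ 2
      + (∫ s in (0 : ℝ)..t, Real.exp (-(2 * k * s)) * (α * ‖curve x s‖ ^ 2))
      - ∫ s in (0 : ℝ)..t, Real.exp (-(2 * k * s)) * (‖curveRhs i a x s‖ ^ 2 / α)
  have hG : ∀ t, HasDerivAt G (Real.exp (-(2 * k * t)) * (-(2 * k)) * ‖i (curve x t)‖ ^ 2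
      + Real.exp (-(2 * k * t)) * (2 * ⟪i (curve x t), i (x.2 t)⟫)
      + Real.exp (-(2 * k * t)) * (α * ‖curve x t‖ ^ 2)
      - Real.exp (-(2 * k * t)) * (‖curveRhs i a x t‖ ^ 2 / α)) t := fun t => by
    have h1 : HasDerivAt (fun t => i (curve x t)) (i (x.2 t)) t :=
      i.hasFDerivAt.comp_hasDerivAt t (hasDerivAt_curve x t)
    have h2 : HasDerivAt (fun t : ℝ => -(2 * k * t)) (-(2 * k)) t := by
      simpa using (hasDerivAt_id t).const_mul (-(2 * k))
    exact ((h2.exp.mul h1.norm_sq).add (intervalIntegral.integral_hasDerivAt_right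
      (c1.intervalIntegrable _ _) (c1.stronglyMeasurableAtFilter _ _) c1.continuousAt)).sub
      (intervalIntegral.integral_hasDerivAt_right
      (c2.intervalIntegrable _ _) (c2.stronglyMeasurableAtFilter _ _) c2.continuousAt)
  have hanti : Antitone G := by
    refine antitone_of_deriv_nonpos (fun t => (hG t).differentiableAt) fun t => ?_
    rw [(hG t).deriv]
    have e1 : ⟪i (curve x t), i (x.2 t)⟫
        = ⟪curveRhs i a x t, curve x t⟫ - ⟪a (curve x t), curve x t⟫ := by
      rw [curveRhs_apply, inner_add_left, adjoint_inner_left, real_inner_comm]; ring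
    have e2 := real_inner_le_norm (curveRhs i a x t) (curve x t)
    have e3 := h (curve x t)
    have e4 : 2 * (‖curveRhs i a x t‖ * ‖curve x t‖)
        ≤ α * ‖curve x t‖ ^ 2 + ‖curveRhs i a x t‖ ^ 2 / α := by
      have : 0 ≤ (α * ‖curve x t‖ - ‖curveRhs i a x t‖) ^ 2 / α := by positivity
      have e : (α * ‖curve x t‖ - ‖curveRhs i a x t‖) ^ 2 / α
          = α * ‖curve x t‖ ^ 2 + ‖curveRhs i a x t‖ ^ 2 / α
            - 2 * (‖curveRhs i a x t‖ * ‖curve x t‖) := by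
        field_simp; ring
      linarith
    have e5 : (-(2 * k)) * ‖i (curve x t)‖ ^ 2 + 2 * ⟪i (curve x t), i (x.2 t)⟫
      + α * ‖curve x t‖ ^ 2 - ‖curveRhs i a x t‖ ^ 2 / α ≤ 0 := by
      rw [e1]; linarith
    have := mul_nonpos_of_nonneg_of_nonpos (Real.exp_pos (-(2 * k * t))).le e5
    linarith
  have := hanti ht
  simp only [G, intervalIntegral.integral_same, curve_zero] at this
  simp only [mul_zero, neg_zero, Real.exp_zero, one_mul, add_zero, sub_zero] at this
  linarith

theorem integral_timeMeasure_eq {T : ℝ} (hT : 0 ≤ T) {X : Type*} [NormedAddCommGroup X]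
    [NormedSpace ℝ X] (f : ℝ → X) : ∫ t, f t ∂(timeMeasure T) = ∫ t in (0 : ℝ)..T, f t := by
  rw [← prim_at_end hT, prim_eq_integral ⟨hT, le_rfl⟩]

theorem exists_energy_bound {i : V →L[ℝ] H} {a : V →L[ℝ] V} {α k : ℝ}
    (h : Garding i a α k) (hα : 0 < α) (hk : 0 ≤ k) {T : ℝ} (hT : 0 ≤ T) :
    ∃ C : ℝ, 0 ≤ C ∧ ∀ x : V × C(ℝ, V),
      (∀ t ∈ Icc 0 T, ‖i (curve x t)‖ ^ 2
        ≤ C * (‖i x.1‖ ^ 2 + ∫ t, ‖curveRhs i a x t‖ ^ 2 ∂(timeMeasure T))) ∧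
      ∫ t, ‖curve x t‖ ^ 2 ∂(timeMeasure T)
        ≤ C * (‖i x.1‖ ^ 2 + ∫ t, ‖curveRhs i a x t‖ ^ 2 ∂(timeMeasure T)) := by
  let c0 := Real.exp (2 * k * T)
  let c1 := 1 + 1 / α
  have hc1 : 1 ≤ c1 := by
    have : 0 < 1 / α := by positivity
    simp only [c1]
    linarith
  have hc1' : 1 / α ≤ c1 := by simp [c1]
  have hc0 : 0 < c0 := Real.exp_pos _
  -- One constant for both bounds: `c0` removes the exponential weight, one factor `c1` bounds the
  -- weighted data, and the other absorbs the `1 / α` of the integral bound.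
  refine ⟨c0 * c1 * c1, by positivity, fun x => ?_⟩
  set R := ∫ t, ‖curveRhs i a x t‖ ^ 2 ∂(timeMeasure T) with hR
  have hR0 : 0 ≤ R := integral_nonneg fun t => by positivity
  have hlow : ∀ s ∈ Icc 0 T, 1 ≤ c0 * Real.exp (-(2 * k * s)) := fun s hs => by
    rw [← Real.exp_add, Real.one_le_exp_iff]
    have : k * s ≤ k * T := by gcongr; exact hs.2
    linarith
  have hup : ∀ s, 0 ≤ s → Real.exp (-(2 * k * s)) ≤ 1 := fun s hs => by
    rw [Real.exp_le_one_iff]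
    have : 0 ≤ k * s := mul_nonneg hk hs
    linarith
  have hrhs : ∀ t ∈ Icc 0 T,
      ‖i x.1‖ ^ 2 + ∫ s in (0 : ℝ)..t, Real.exp (-(2 * k * s)) * (‖curveRhs i a x s‖ ^ 2 / α)
        ≤ c1 * (‖i x.1‖ ^ 2 + R) := fun t ht => by
    have e1 : ∫ s in (0 : ℝ)..t, Real.exp (-(2 * k * s)) * (‖curveRhs i a x s‖ ^ 2 / α)
        ≤ ∫ s in (0 : ℝ)..t, ‖curveRhs i a x s‖ ^ 2 / α := by
      refine intervalIntegral.integral_mono_on ht.1 ?_ ?_ fun s hs => ?_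
      · exact Continuous.intervalIntegrable (by fun_prop) _ _
      · exact Continuous.intervalIntegrable (by fun_prop) _ _
      · exact mul_le_of_le_one_left (by positivity) (hup s hs.1)
    have e2 : ∫ s in (0 : ℝ)..t, ‖curveRhs i a x s‖ ^ 2 / α
        ≤ ∫ s in (0 : ℝ)..T, ‖curveRhs i a x s‖ ^ 2 / α := by
      refine intervalIntegral.integral_mono_interval le_rfl ht.1 ht.2 ?_ ?_
      · exact Filter.Eventually.of_forall fun s => by
          change 0 ≤ ‖curveRhs i a x s‖ ^ 2 / α
          positivity
      · exact Continuous.intervalIntegrable (by fun_prop) _ _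
    have e3 : ∫ s in (0 : ℝ)..T, ‖curveRhs i a x s‖ ^ 2 / α = 1 / α * R := by
      rw [intervalIntegral.integral_div, hR, integral_timeMeasure_eq hT]; ring
    have e4 : 1 / α * R ≤ c1 * R := by gcongr
    have e5 : ‖i x.1‖ ^ 2 ≤ c1 * ‖i x.1‖ ^ 2 := le_mul_of_one_le_left (by positivity) hc1
    linarith
  have hE : 0 ≤ ‖i x.1‖ ^ 2 + R := by positivity
  constructor
  · intro t ht
    have h1 := energy_estimate h hα x ht.1
    have h2 : 0 ≤ ∫ s in (0 : ℝ)..t, Real.exp (-(2 * k * s)) * (α * ‖curve x s‖ ^ 2) :=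
      intervalIntegral.integral_nonneg ht.1 fun s _ => by positivity
    have h3 := hrhs t ht
    calc ‖i (curve x t)‖ ^ 2 ≤ c0 * Real.exp (-(2 * k * t)) * ‖i (curve x t)‖ ^ 2 :=
          le_mul_of_one_le_left (by positivity) (hlow t ht)
      _ = c0 * (Real.exp (-(2 * k * t)) * ‖i (curve x t)‖ ^ 2) := by ring
      _ ≤ c0 * (c1 * (‖i x.1‖ ^ 2 + R)) := mul_le_mul_of_nonneg_left (by linarith) hc0.le
      _ ≤ c0 * (c1 * (‖i x.1‖ ^ 2 + R)) * c1 := le_mul_of_one_le_right (by positivity) hc1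
      _ = _ := by ring
  · have h1 := energy_estimate h hα x hT
    have h2 : 0 ≤ Real.exp (-(2 * k * T)) * ‖i (curve x T)‖ ^ 2 := by positivity
    have h3 := hrhs T ⟨hT, le_rfl⟩
    rw [integral_timeMeasure_eq hT]
    calc ∫ s in (0 : ℝ)..T, ‖curve x s‖ ^ 2
        ≤ ∫ s in (0 : ℝ)..T, c0 / α * (Real.exp (-(2 * k * s)) * (α * ‖curve x s‖ ^ 2)) := by
          refine intervalIntegral.integral_mono_on hT ?_ ?_ fun s hs => ?_
          · exact Continuous.intervalIntegrable (by fun_prop) _ _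
          · exact Continuous.intervalIntegrable (by fun_prop) _ _
          · have : c0 / α * (Real.exp (-(2 * k * s)) * (α * ‖curve x s‖ ^ 2))
              = c0 * Real.exp (-(2 * k * s)) * ‖curve x s‖ ^ 2 := by field_simp
            rw [this]
            exact le_mul_of_one_le_left (by positivity) (hlow s hs)
      _ = c0 * (1 / α) * ∫ s in (0 : ℝ)..T, Real.exp (-(2 * k * s)) * (α * ‖curve x s‖ ^ 2) := by
          rw [intervalIntegral.integral_const_mul]; ring
      _ ≤ c0 * c1 * (c1 * (‖i x.1‖ ^ 2 + R)) :=
          mul_le_mul (mul_le_mul_of_nonneg_left hc1' hc0.le) (by linarith)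
            (intervalIntegral.integral_nonneg hT fun s _ => by positivity) (by positivity)
      _ = _ := by ring

/-- The pair of right-hand side and initial value generated by a curve. -/
def curveData (i : V →L[ℝ] H) (a : V →L[ℝ] V) (T : ℝ) :
    V × C(ℝ, V) →ₗ[ℝ] WithLp 2 (Lp V 2 (timeMeasure T) × H) where
  toFun x := WithLp.toLp 2 (contToLp T (curveRhs i a x), i x.1)
  map_add' x y := by
    rw [map_add, map_add, Prod.fst_add, map_add]; rfl
  map_smul' c x := by
    rw [map_smul, map_smul, Prod.smul_fst, map_smul]; rfl

theorem norm_sq_curveData (i : V →L[ℝ] H) (a : V →L[ℝ] V) (T : ℝ) (x : V × C(ℝ, V)) :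
    ‖curveData i a T x‖ ^ 2
      = ‖i x.1‖ ^ 2 + ∫ t, ‖curveRhs i a x t‖ ^ 2 ∂(timeMeasure T) := by
  rw [WithLp.prod_norm_sq_eq_of_L2, ← norm_sq_contToLp, add_comm]
  rfl

/-- Curves starting at zero show that the first component `w` satisfies `i* i w + a* ∫ₜᵀ w = 0`. The
adjoint obeys the same Gårding inequality, so backward uniqueness gives `w = 0`. Constant curves
then settle the second component. -/
theorem eq_zero_of_orthogonal_curveData {i : V →L[ℝ] H} {a : V →L[ℝ] V} {α k : ℝ}
    (h : Garding i a α k) (hα : 0 < α) {T : ℝ} (hT : 0 < T)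
    {y : WithLp 2 (Lp V 2 (timeMeasure T) × H)}
    (hy : ∀ x, ⟪curveData i a T x, y⟫ = 0) : y.fst = 0 ∧ ∀ v, ⟪i v, y.snd⟫ = 0 := by
  set w := y.fst with hw
  have hwL : MemL2 T w := Lp.memLp w
  have hwi : Integrable w (timeMeasure T) := hwL.integrable
  have hxy : ∀ x, ∫ t, ⟪curveRhs i a x t, w t⟫ ∂(timeMeasure T) + ⟪i x.1, y.snd⟫ = 0 := fun x => by
    have h1 := hy x
    rw [WithLp.prod_inner_apply] at h1
    change ⟪contToLp T (curveRhs i a x), w⟫ + ⟪i x.1, y.snd⟫ = 0 at h1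
    rw [L2.inner_def] at h1
    rw [← h1]
    congr 1
    refine integral_congr_ae ?_
    filter_upwards [coeFn_contToLp T (curveRhs i a x)] with t ht
    rw [ht]
  have key : w =ᵐ[timeMeasure T] (0 : ℝ → V) := by
    refine h.of_adjoint.ae_eq_zero_backward hα hwi ?_
    have hWc : Continuous fun t => prim T w T - prim T w t :=
      continuous_const.sub (continuous_prim hwi)
    have i1 : Integrable (fun t => adjoint i (i (w t))) (timeMeasure T) :=
      ((adjoint i).comp i).integrable_comp hwi
    have i2 : Integrable (fun t => adjoint a (prim T w T - prim T w t)) (timeMeasure T) :=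
      MemL2.integrable ((adjoint a).continuous.comp hWc).continuousOn.memL2
    refine ae_eq_of_forall_test (i1.add i2).locallyIntegrableOn_Ioo
      (integrable_zero _ _ _).locallyIntegrableOn_Ioo fun ψ => ?_
    have hsm : Integrable (fun t => ψ t • (adjoint i (i (w t))
        + adjoint a (prim T w T - prim T w t))) (timeMeasure T) :=
      ψ.continuous.integrable_smul_timeMeasure (i1.add i2)
    simp only [smul_zero, integral_zero]
    refine ext_inner_left ℝ fun v => ?_
    rw [inner_zero_right, ← integral_inner hsm]
    -- The test curve is `Ψ(t) v`, with derivative `ψ(t) v`. Since `Ψ` need not vanish at `T`,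
    -- integration by parts produces the tail `∫ₜᵀ w`.
    let Ψ : ℝ → ℝ := fun t => ∫ s in (0 : ℝ)..t, ψ s
    have hΨd : ∀ t, HasDerivAt Ψ (ψ t) t := fun t =>
      intervalIntegral.integral_hasDerivAt_right (ψ.continuous.intervalIntegrable 0 t)
        (ψ.continuous.stronglyMeasurableAtFilter _ _) ψ.continuous.continuousAt
    have hΨ' : deriv Ψ = ψ := funext fun t => (hΨd t).deriv
    have hΨ : ContDiff ℝ 1 Ψ := by
      rw [contDiff_one_iff_deriv, hΨ']
      exact ⟨fun t => (hΨd t).differentiableAt, ψ.continuous⟩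
    have hx := hxy (0, ⟨fun t => ψ t • v, by fun_prop⟩)
    have hcurve : ∀ t, curve ((0 : V), (⟨fun t => ψ t • v, by fun_prop⟩ : C(ℝ, V))) t = Ψ t • v :=
      fun t => by
        rw [curve_apply]
        simp only [ContinuousMap.coe_mk, zero_add]
        exact intervalIntegral.integral_smul_const _ _
    have hbp := integral_deriv_smul_prim hT.le hwi hΨ
    rw [hΨ'] at hbp
    have hΨT : Ψ T = ∫ t, ψ t ∂(timeMeasure T) := (integral_timeMeasure_eq hT.le _).symm
    have hΨw : Integrable (fun t => Ψ t • w t) (timeMeasure T) :=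
      hΨ.continuous.integrable_smul_timeMeasure hwi
    have hψw : Integrable (fun t => ψ t • w t) (timeMeasure T) :=
      ψ.continuous.integrable_smul_timeMeasure hwi
    have hψi : Integrable ψ (timeMeasure T) := ψ.continuous.continuousOn.memL2.integrable
    have hψp : Integrable (fun t => ψ t • prim T w t) (timeMeasure T) :=
      (ψ.continuous.smul (continuous_prim hwi)).continuousOn.memL2.integrable
    have e1 : ∫ t, ψ t • (prim T w T - prim T w t) ∂(timeMeasure T)
        = ∫ t, Ψ t • w t ∂(timeMeasure T) := by
      simp only [smul_sub]
      rw [integral_sub (hψi.smul_const _) hψp, integral_smul_const, hbp, hΨT]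
      abel
    have hψW : Integrable (fun t => ψ t • (prim T w T - prim T w t)) (timeMeasure T) :=
      (ψ.continuous.smul hWc).continuousOn.memL2.integrable
    have lhs : ∫ t, ⟪v, ψ t • (adjoint i (i (w t)) + adjoint a (prim T w T - prim T w t))⟫
        ∂(timeMeasure T) = ⟪adjoint i (i v), ∫ t, ψ t • w t ∂(timeMeasure T)⟫
        + ⟪a v, ∫ t, ψ t • (prim T w T - prim T w t) ∂(timeMeasure T)⟫ := by
      rw [← integral_inner hψw, ← integral_inner hψW,
        ← integral_add (hψw.const_inner _) (hψW.const_inner _)]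
      refine integral_congr_ae (Eventually.of_forall fun t => ?_)
      simp only [inner_add_right, inner_smul_right, adjoint_inner_right, adjoint_inner_left]
      ring
    rw [lhs, e1, ← integral_inner hψw, ← integral_inner hΨw,
        ← integral_add (hψw.const_inner _) (hΨw.const_inner _)]
    simp only [map_zero, inner_zero_left, add_zero] at hx
    rw [← hx]
    refine integral_congr_ae (Eventually.of_forall fun t => ?_)
    simp only [curveRhs_apply, hcurve, ContinuousMap.coe_mk, map_smul, inner_add_left,
      inner_smul_left, inner_smul_right]
    simp
  refine ⟨(Lp.eq_zero_iff_ae_eq_zero).2 key, fun v => ?_⟩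
  have h1 := hxy (v, 0)
  have h2 : ∫ t, ⟪curveRhs i a (v, 0) t, w t⟫ ∂(timeMeasure T) = 0 := by
    rw [← integral_zero ℝ ℝ (μ := timeMeasure T)]
    refine integral_congr_ae ?_
    filter_upwards [key] with t ht
    rw [ht]; simp
  rw [h2, zero_add] at h1
  exact h1

theorem mem_closure_range_curveData {i : V →L[ℝ] H} {a : V →L[ℝ] V} {α k : ℝ}
    (h : Garding i a α k) (hα : 0 < α) {T : ℝ} (hT : 0 < T) (F : Lp V 2 (timeMeasure T))
    {u0 : H} (hu0 : u0 ∈ closure (range i)) :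
    WithLp.toLp 2 (F, u0) ∈ closure (range (curveData i a T)) := by
  have h1 : WithLp.toLp 2 (F, u0) ∈ (LinearMap.range (curveData i a T))ᗮᗮ := by
    rw [Submodule.mem_orthogonal]
    intro y hy
    rw [Submodule.mem_orthogonal] at hy
    obtain ⟨h1, h2⟩ := eq_zero_of_orthogonal_curveData h hα hT (y := y)
      fun x => hy _ ⟨x, rfl⟩
    rw [WithLp.prod_inner_apply]
    have h3 : ⟪y.snd, u0⟫ = 0 := by
      have hcl : IsClosed {u : H | ⟪y.snd, u⟫ = 0} :=
        isClosed_eq (by fun_prop) continuous_const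
      refine closure_minimal ?_ hcl hu0
      rintro _ ⟨v, rfl⟩
      change ⟪y.snd, i v⟫ = 0
      rw [real_inner_comm, h2]
    change ⟪y.fst, F⟫ + ⟪y.snd, u0⟫ = 0
    rw [h1, h3, inner_zero_left, add_zero]
  rw [Submodule.orthogonal_orthogonal_eq_closure] at h1
  exact h1

end ParabolicExistence
end

/-! ### Solutions as limits of curves -/

noncomputable section

section ParabolicSolution

open Filter Topology ContinuousLinearMap

variable {V H : Type*} [NormedAddCommGroup V] [InnerProductSpace ℝ V] [CompleteSpace V]
  [NormedAddCommGroup H] [InnerProductSpace ℝ H] [CompleteSpace H]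

theorem CauchySeq.of_linear_bound {E F G : Type*} [AddCommGroup E] [Module ℝ E]
    [SeminormedAddCommGroup F] [NormedSpace ℝ F] [SeminormedAddCommGroup G] [NormedSpace ℝ G]
    (R : E →ₗ[ℝ] F) (S : E →ₗ[ℝ] G) {K : ℝ} (hK : 0 ≤ K) (h : ∀ x, ‖S x‖ ≤ K * ‖R x‖) {x : ℕ → E}
    (hx : CauchySeq fun n => R (x n)) : CauchySeq fun n => S (x n) := by
  rw [Metric.cauchySeq_iff] at hx ⊢
  intro ε hε
  obtain ⟨N, hN⟩ := hx (ε / (K + 1)) (by positivity)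
  refine ⟨N, fun m hm n hn => ?_⟩
  have h1 := hN m hm n hn
  rw [dist_eq_norm, ← map_sub, lt_div_iff₀ (by positivity)] at h1
  rw [dist_eq_norm, ← map_sub]
  have h2 := h (x m - x n)
  have h3 := norm_nonneg (R (x m - x n))
  nlinarith

/-- The trace of a curve in `C([0,T],H)`. -/
def curveTrace (i : V →L[ℝ] H) (T : ℝ) : V × C(ℝ, V) →ₗ[ℝ] C(Icc 0 T, H) where
  toFun x := ⟨fun t => i (curve x t), by fun_prop⟩
  map_add' x y := by ext t; simp
  map_smul' c x := by ext t; simp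

/-- Pairing a primitive at time `t` with `c` is the `L²` inner product with the function equal to
`c` on `(0,t]` and zero elsewhere. -/
theorem tendsto_inner_prim {T : ℝ} {f : ℕ → Lp V 2 (timeMeasure T)} {g : Lp V 2 (timeMeasure T)}
    (h : Tendsto f atTop (𝓝 g)) {t : ℝ} (ht : 0 ≤ t) (c : V) :
    Tendsto (fun n => ⟪c, prim T (f n) t⟫) atTop (𝓝 ⟪c, prim T g t⟫) := by
  have key : ∀ f : Lp V 2 (timeMeasure T), ⟪c, prim T f t⟫
      = ⟪indicatorConstLp 2 (measurableSet_Ioc (a := 0) (b := t)) (measure_ne_top _ _) c, f⟫ :=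
    fun f => by
      rw [L2.inner_indicatorConstLp_eq_inner_setIntegral, prim, intervalIntegral.integral_of_le ht]
  simp only [key]
  exact tendsto_const_nhds.inner h

/-- The integrated equation contains no time derivative, so it survives a limit in which only the
curves, their traces in `H` and their data converge. -/
theorem curve_integral_eq {i : V →L[ℝ] H} {a : V →L[ℝ] V} {T : ℝ} (x : V × C(ℝ, V)) {t : ℝ}
    (ht : t ∈ Icc 0 T) :
    adjoint i (i (curve x t)) + a (prim T (contToLp T (curve x)) t)
      = adjoint i (i x.1) + prim T (contToLp T (curveRhs i a x)) t := by
  have h1 : Integrable x.2 (timeMeasure T) := x.2.continuous.continuousOn.memL2.integrable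
  have h2 : Integrable (curve x) (timeMeasure T) :=
    (curve x).continuous.continuousOn.memL2.integrable
  rw [prim_congr (coeFn_contToLp T (curve x)), prim_congr (coeFn_contToLp T (curveRhs i a x))]
  have e : prim T (curveRhs i a x) t
      = adjoint i (i (prim T x.2 t)) + a (prim T (curve x) t) := by
    rw [← prim_clm h2 a]
    rw [show adjoint i (i (prim T x.2 t)) = prim T (fun t => adjoint i (i (x.2 t))) t from
      (prim_clm h1 ((adjoint i).comp i) t).symm]
    exact prim_add (((adjoint i).comp i).integrable_comp h1) (a.integrable_comp h2) t
  rw [e, curve_apply, ← prim_eq_integral ht, map_add, map_add]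
  abel

theorem Garding.exists_solution {i : V →L[ℝ] H} {a : V →L[ℝ] V} {α k : ℝ}
    (h : Garding i a α k) (hα : 0 < α) (hk : 0 ≤ k) {T : ℝ} (hT : 0 < T) {F : ℝ → V}
    (hF : MemL2 T F) {u0 : H} (hu0 : u0 ∈ closure (range i)) :
    ∃ (u : ℝ → V) (w : ℝ → H), MemL2 T u ∧ ContinuousOn w (Icc 0 T) ∧
      (∀ᵐ t ∂(timeMeasure T), i (u t) = w t) ∧ w 0 = u0 ∧
      ∀ t ∈ Icc 0 T, adjoint i (w t) + a (prim T u t) = adjoint i u0 + prim T F t := by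
  obtain ⟨y, hy, hlim⟩ := mem_closure_iff_seq_limit.1
    (mem_closure_range_curveData h hα hT (MemLp.toLp F hF) hu0)
  choose x hx using hy
  obtain rfl : (fun n => curveData i a T (x n)) = y := funext hx
  obtain ⟨C, hC, hbound⟩ := exists_energy_bound h hα hk hT.le
  simp only [← norm_sq_curveData] at hbound
  have hroot : ∀ {r s : ℝ}, 0 ≤ s → r ^ 2 ≤ C * s ^ 2 → r ≤ √C * s := fun {r s} hs hrs => by
    refine Real.le_sqrt_of_sq_le hrs |>.trans ?_
    rw [Real.sqrt_mul hC, Real.sqrt_sq hs]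
  obtain ⟨u, hu⟩ := cauchySeq_tendsto_of_complete
    (CauchySeq.of_linear_bound (curveData i a T) ((contToLp T).comp curve) (Real.sqrt_nonneg C)
      (fun z => hroot (norm_nonneg _) (by
        rw [LinearMap.comp_apply, norm_sq_contToLp]; exact (hbound z).2)) hlim.cauchySeq)
  obtain ⟨W, hW⟩ := cauchySeq_tendsto_of_complete
    (CauchySeq.of_linear_bound (curveData i a T) (curveTrace i T) (Real.sqrt_nonneg C)
      (fun z => (ContinuousMap.norm_le _ (by positivity)).2 fun t =>
        hroot (norm_nonneg _) ((hbound z).1 t t.2)) hlim.cauchySeq)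
  have hWt : ∀ t (ht : t ∈ Icc 0 T),
      Tendsto (fun n => i (curve (x n) t)) atTop (𝓝 (W ⟨t, ht⟩)) := fun t ht =>
    ((continuous_eval_const (⟨t, ht⟩ : Icc 0 T)).tendsto W).comp hW
  have hFlim : Tendsto (fun n => contToLp T (curveRhs i a (x n))) atTop (𝓝 (MemLp.toLp F hF)) :=
    ((WithLp.prod_continuous_ofLp 2 _ _).fst.tendsto _).comp hlim
  have h0lim : Tendsto (fun n => i (x n).1) atTop (𝓝 u0) :=
    ((WithLp.prod_continuous_ofLp 2 _ _).snd.tendsto _).comp hlim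
  have hext : ∀ t (ht : t ∈ Icc 0 T), IccExtend hT.le W t = W ⟨t, ht⟩ := fun t ht =>
    IccExtend_of_mem hT.le W ht
  have hW0 : W ⟨0, le_rfl, hT.le⟩ = u0 := by
    refine tendsto_nhds_unique (hWt 0 ⟨le_rfl, hT.le⟩) ?_
    simp only [curve_zero]
    exact h0lim
  refine ⟨u, IccExtend hT.le W, Lp.memLp u, (W.continuous.Icc_extend' ).continuousOn, ?_, ?_, ?_⟩
  -- An a.e. convergent subsequence identifies the `L²` limit with the uniform limit of the traces.
  · obtain ⟨ns, hns, hae⟩ := (tendstoInMeasure_of_tendsto_Lp hu).exists_seq_tendsto_ae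
    have hall := ae_all_iff.2 fun n => coeFn_contToLp T (curve (x n))
    filter_upwards [hae, hall, ae_timeMeasure_mem T] with t h1 h2 ht
    have ht' := Ioo_subset_Icc_self ht
    rw [hext t ht']
    refine tendsto_nhds_unique ?_ ((hWt t ht').comp hns.tendsto_atTop)
    have h3 := (i.continuous.tendsto _).comp h1
    refine h3.congr fun n => ?_
    simp only [Function.comp_apply, LinearMap.comp_apply]
    rw [h2]
  · rw [hext 0 ⟨le_rfl, hT.le⟩, hW0]
  · intro t ht
    rw [hext t ht]
    refine ext_inner_left ℝ fun c => ?_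
    have l1 : Tendsto (fun n => ⟪c, adjoint i (i (curve (x n) t))⟫
        + ⟪adjoint a c, prim T (contToLp T (curve (x n))) t⟫) atTop
        (𝓝 (⟪c, adjoint i (W ⟨t, ht⟩)⟫ + ⟪adjoint a c, prim T u t⟫)) :=
      (tendsto_const_nhds.inner (((adjoint i).continuous.tendsto _).comp (hWt t ht))).add
        (tendsto_inner_prim hu ht.1 _)
    have l2 : Tendsto (fun n => ⟪c, adjoint i (i (x n).1)⟫
        + ⟪c, prim T (contToLp T (curveRhs i a (x n))) t⟫) atTop
        (𝓝 (⟪c, adjoint i u0⟫ + ⟪c, prim T (MemLp.toLp F hF) t⟫)) :=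
      (tendsto_const_nhds.inner (((adjoint i).continuous.tendsto _).comp h0lim)).add
        (tendsto_inner_prim hFlim ht.1 _)
    have e : ∀ n, ⟪c, adjoint i (i (curve (x n) t))⟫
        + ⟪adjoint a c, prim T (contToLp T (curve (x n))) t⟫ = ⟪c, adjoint i (i (x n).1)⟫
        + ⟪c, prim T (contToLp T (curveRhs i a (x n))) t⟫ := fun n => by
      have := congrArg (fun v => ⟪c, v⟫) (curve_integral_eq (i := i) (a := a) (x n) ht)
      simp only [inner_add_right] at this
      rw [adjoint_inner_left, this]
    simp only [e] at l1
    have := tendsto_nhds_unique l1 l2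
    rw [adjoint_inner_left, prim_congr hF.coeFn_toLp] at this
    rw [inner_add_right, inner_add_right, this]

end ParabolicSolution
end

/-! ### Dual-space formulation, the reduced operator and the multiplier -/

noncomputable section

section DualForm

open ContinuousLinearMap

variable {V H : Type*} [NormedAddCommGroup V] [InnerProductSpace ℝ V] [CompleteSpace V]
  [NormedAddCommGroup H] [InnerProductSpace ℝ H] [CompleteSpace H]

/-- The Riesz isomorphism `V* ≃ V` of a real Hilbert space. -/
def rieszEquiv (V : Type*) [NormedAddCommGroup V] [InnerProductSpace ℝ V] [CompleteSpace V] :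
    StrongDual ℝ V ≃L[ℝ] V :=
  (InnerProductSpace.toDual ℝ V).symm.toContinuousLinearEquiv

/-- The Riesz map `V* → V`. -/
def riesz (V : Type*) [NormedAddCommGroup V] [InnerProductSpace ℝ V] [CompleteSpace V] :
    StrongDual ℝ V →L[ℝ] V :=
  rieszEquiv V

@[simp] theorem inner_riesz (F : StrongDual ℝ V) (v : V) : ⟪riesz V F, v⟫ = F v :=
  InnerProductSpace.toDual_symm_apply (𝕜 := ℝ) (E := V)

theorem riesz_injective : Function.Injective (riesz V) :=
  (rieszEquiv V).injective

theorem adjoint_eq_riesz {i : V →L[ℝ] H} {e : H →L[ℝ] StrongDual ℝ V}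
    (he : ∀ x v, e x v = ⟪x, i v⟫) (x : H) : adjoint i x = riesz V (e x) := by
  refine ext_inner_right ℝ fun v => ?_
  rw [adjoint_inner_left, inner_riesz, he]

theorem garding_riesz {i : V →L[ℝ] H} {a : V →L[ℝ] StrongDual ℝ V} {α k : ℝ}
    (h : ∀ v, α * ‖v‖ ^ 2 ≤ a v v + k * ‖i v‖ ^ 2) : Garding i ((riesz V).comp a) α k := fun v => by
  rw [ContinuousLinearMap.comp_apply, inner_riesz]; exact h v

theorem exists_parabolic_solution {i : V →L[ℝ] H} {e : H →L[ℝ] StrongDual ℝ V}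
    (he : ∀ x v, e x v = ⟪x, i v⟫) {a : V →L[ℝ] StrongDual ℝ V} {α k : ℝ}
    (h : ∀ v, α * ‖v‖ ^ 2 ≤ a v v + k * ‖i v‖ ^ 2) (hα : 0 < α) (hk : 0 ≤ k) {T : ℝ} (hT : 0 < T)
    {F : ℝ → StrongDual ℝ V} (hF : MemL2 T F) {x : H} (hx : x ∈ closure (range i)) :
    ∃ (u : ℝ → V) (w : ℝ → H), MemL2 T u ∧ ContinuousOn w (Icc 0 T) ∧
      (∀ᵐ t ∂(timeMeasure T), i (u t) = w t) ∧ w 0 = x ∧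
      ∀ t ∈ Icc 0 T, e (w t) + a (prim T u t) = e x + prim T F t := by
  obtain ⟨u, w, h1, h2, h3, h4, h5⟩ :=
    (garding_riesz h).exists_solution hα hk hT (hF.clm (riesz V)) hx
  refine ⟨u, w, h1, h2, h3, h4, fun t ht => riesz_injective ?_⟩
  have := h5 t ht
  rw [adjoint_eq_riesz he, adjoint_eq_riesz he, prim_clm hF.integrable] at this
  rw [map_add, map_add]
  exact this

theorem parabolic_ae_eq_zero {i : V →L[ℝ] H} {e : H →L[ℝ] StrongDual ℝ V}
    (he : ∀ x v, e x v = ⟪x, i v⟫) {a : V →L[ℝ] StrongDual ℝ V} {α k : ℝ}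
    (h : ∀ v, α * ‖v‖ ^ 2 ≤ a v v + k * ‖i v‖ ^ 2) (hα : 0 < α) {T : ℝ} {u : ℝ → V}
    (hu : Integrable u (timeMeasure T))
    (heq : ∀ᵐ t ∂(timeMeasure T), e (i (u t)) + a (prim T u t) = 0) :
    u =ᵐ[timeMeasure T] 0 := by
  refine (garding_riesz h).ae_eq_zero hα hu ?_
  filter_upwards [heq] with t ht
  rw [adjoint_eq_riesz he, ContinuousLinearMap.comp_apply, ← map_add, ht, map_zero]

end DualForm

theorem clm_integral_smul {X Y : Type*} [NormedAddCommGroup X] [NormedSpace ℝ X]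
    [NormedAddCommGroup Y] [NormedSpace ℝ Y] [CompleteSpace X] [CompleteSpace Y] (L : X →L[ℝ] Y)
    {T : ℝ} {φ : ℝ → ℝ} (hφ : Continuous φ) {u : ℝ → X} (hu : Integrable u (timeMeasure T)) :
    L (∫ t, φ t • u t ∂(timeMeasure T)) = ∫ t, φ t • L (u t) ∂(timeMeasure T) := by
  rw [← L.integral_comp_comm (hφ.integrable_smul_timeMeasure hu)]
  simp only [map_smul]

namespace ConstrainedSystem

variable {P H M Q : Type*}
  [NormedAddCommGroup P] [InnerProductSpace ℝ P] [CompleteSpace P]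
  [NormedAddCommGroup H] [InnerProductSpace ℝ H] [CompleteSpace H]
  [NormedAddCommGroup M] [InnerProductSpace ℝ M] [CompleteSpace M]
  [NormedAddCommGroup Q] [InnerProductSpace ℝ Q] [CompleteSpace Q]
  (S : ConstrainedSystem P H M Q)

instance : CompleteSpace S.Pker :=
  (ContinuousLinearMap.isClosed_ker S.B).completeSpace_coe

theorem B_coe (q : S.Pker) : S.B q = 0 := q.2

theorem mem_Pker {q : P} : q ∈ S.Pker ↔ S.B q = 0 := Iff.rfl

theorem D_Dinv (y : StrongDual ℝ M) : S.D (S.Dinv y) = y := S.D_isInvertible.self_apply_inverse y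

theorem Dinv_D (m : M) : S.Dinv (S.D m) = m := S.D_isInvertible.inverse_apply_self m

/-- The restriction of functionals to `P_ker`, as a bounded operator. -/
def restrictL : StrongDual ℝ P →L[ℝ] StrongDual ℝ S.Pker :=
  (ContinuousLinearMap.compL ℝ S.Pker P ℝ).flip S.Pker.subtypeL

theorem restrictL_apply (F : StrongDual ℝ P) (q : S.Pker) : S.restrictL F q = F q := rfl

theorem restrictL_Bdual (μ : Q) : S.restrictL (S.Bdual μ) = 0 := by
  ext q
  rw [restrictL_apply]
  change S.B q μ = 0
  rw [B_coe]; rfl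

/-- The operator `A + L` on `P_ker`. -/
def kerOp : S.Pker →L[ℝ] StrongDual ℝ S.Pker :=
  S.restrictL.comp ((S.AP + S.L).comp S.Pker.subtypeL)

theorem kerOp_apply (q : S.Pker) : S.kerOp q = S.restrictL (S.AP q + S.L q) := rfl

theorem L_apply (p : P) : S.L p = S.Kdual (S.Dinv (S.K p)) := rfl

/-- For `m = D⁻¹ K q` one has `⟨L q, q⟩ = ⟨D m, m⟩`, and `c_K ‖q‖ ≤ ‖K q‖ = ‖D m‖` bounds `‖m‖` from
below. -/
theorem exists_L_coercive : ∃ α : ℝ, 0 < α ∧ ∀ q : S.Pker, α * ‖q‖ ^ 2 ≤ S.L q q := by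
  obtain ⟨cD, hcD, hD⟩ := S.D_elliptic
  obtain ⟨cK, hcK, hK⟩ := S.K_lower
  -- The `+ 1` keeps the denominator positive when `D = 0`.
  refine ⟨cD * (cK / (‖S.D‖ + 1)) ^ 2, by positivity, fun q => ?_⟩
  set m := S.Dinv (S.K q) with hm
  have h1 : S.L q q = S.D m m := by
    rw [L_apply]
    change S.K q (S.Dinv (S.K q)) = _
    rw [hm, D_Dinv]
  have h2 : cK * ‖(q : P)‖ ≤ (‖S.D‖ + 1) * ‖m‖ := by
    refine (hK q (S.B_coe q)).trans ?_
    rw [show S.K q = S.D m by rw [hm, D_Dinv]]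
    refine (S.D.le_opNorm m).trans ?_
    gcongr
    linarith
  have h3 : cK / (‖S.D‖ + 1) * ‖q‖ ≤ ‖m‖ := by
    rw [div_mul_eq_mul_div, div_le_iff₀ (by positivity), mul_comm ‖m‖]
    exact h2
  rw [h1, mul_assoc, ← mul_pow]
  refine le_trans ?_ (hD m)
  gcongr

theorem exists_kerOp_garding : ∃ α k : ℝ, 0 < α ∧ 0 ≤ k ∧
    ∀ q : S.Pker, α * ‖q‖ ^ 2 ≤ S.kerOp q q + k * ‖S.emb.comp S.Pker.subtypeL q‖ ^ 2 := by
  obtain ⟨α, hα, h⟩ := S.exists_L_coercive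
  refine ⟨α, ‖S.A‖, hα, by positivity, fun q => ?_⟩
  have h1 : S.kerOp q q = S.A (S.emb q) (S.emb q) + S.L q q := rfl
  have h2 : |S.A (S.emb q) (S.emb q)| ≤ ‖S.A‖ * ‖S.emb q‖ * ‖S.emb q‖ :=
    S.A.le_opNorm₂ (S.emb q) (S.emb q)
  have h3 := neg_le_of_abs_le h2
  have h4 := h q
  have h5 : ‖S.emb.comp S.Pker.subtypeL q‖ = ‖S.emb q‖ := rfl
  rw [h1, h5]
  linarith [sq ‖S.emb q‖, mul_assoc ‖S.A‖ ‖S.emb q‖ ‖S.emb q‖,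
    congrArg (‖S.A‖ * ·) (sq ‖S.emb q‖)]

/-- The embedding of `H` into the dual of `P_ker`. -/
def embKer : H →L[ℝ] StrongDual ℝ S.Pker := S.restrictL.comp S.embDual

theorem embKer_apply (x : H) (q : S.Pker) : S.embKer x q = ⟪x, S.emb.comp S.Pker.subtypeL q⟫ :=
  S.embDual_apply x q

theorem embKer_eq (x : H) : S.embKer x = S.restrictL (S.embDual x) := rfl

theorem mem_Hker_iff {x : H} :
    x ∈ S.Hker ↔ x ∈ closure (range (S.emb.comp S.Pker.subtypeL)) := by
  rw [Hker, ← SetLike.mem_coe, Submodule.topologicalClosure_coe, Submodule.map_coe]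
  have : (S.emb : P →ₗ[ℝ] H) '' (S.Pker : Set P) = range (S.emb.comp S.Pker.subtypeL) := by
    ext y
    constructor
    · rintro ⟨q, hq, rfl⟩
      exact ⟨⟨q, hq⟩, rfl⟩
    · rintro ⟨q, rfl⟩
      exact ⟨q, q.2, rfl⟩
  rw [this]

theorem exists_ker_solution {T : ℝ} (hT : 0 < T) {F : ℝ → StrongDual ℝ S.Pker} (hF : MemL2 T F)
    {x : H} (hx : x ∈ S.Hker) :
    ∃ (u : ℝ → S.Pker) (w : ℝ → H), MemL2 T u ∧ ContinuousOn w (Icc 0 T) ∧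
      (∀ᵐ t ∂(timeMeasure T), S.emb (u t) = w t) ∧ w 0 = x ∧
      ∀ t ∈ Icc 0 T, S.embKer (w t) + S.kerOp (prim T u t) = S.embKer x + prim T F t := by
  obtain ⟨α, k, hα, hk, h⟩ := S.exists_kerOp_garding
  exact exists_parabolic_solution S.embKer_apply h hα hk hT hF (S.mem_Hker_iff.1 hx)

theorem ker_solution_unique {T : ℝ} {u : ℝ → S.Pker} (hu : Integrable u (timeMeasure T))
    (heq : ∀ᵐ t ∂(timeMeasure T), S.embKer (S.emb (u t)) + S.kerOp (prim T u t) = 0) :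
    u =ᵐ[timeMeasure T] 0 := by
  obtain ⟨α, k, hα, hk, h⟩ := S.exists_kerOp_garding
  exact parabolic_ae_eq_zero S.embKer_apply h hα hu heq

/-- The restriction of `B` to the orthogonal complement of its kernel. -/
def Bperp : S.Pkerᗮ →L[ℝ] StrongDual ℝ Q := S.B.comp S.Pkerᗮ.subtypeL

theorem Bperp_injective : Function.Injective S.Bperp := by
  rw [injective_iff_map_eq_zero]
  intro q hq
  have h : (q : P) ∈ S.Pker ⊓ S.Pkerᗮ := ⟨hq, q.2⟩
  rw [Submodule.inf_orthogonal_eq_bot] at h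
  exact Subtype.ext h

theorem Bperp_surjective : Function.Surjective S.Bperp := fun y => by
  obtain ⟨q, hq, hy⟩ := S.exists_lift y
  exact ⟨⟨q, hq⟩, hy⟩

/-- The right inverse `B⁻` as a bounded operator. -/
def BminusL : StrongDual ℝ Q →L[ℝ] P :=
  S.Pkerᗮ.subtypeL.comp
    ((ContinuousLinearEquiv.ofBijective S.Bperp (LinearMap.ker_eq_bot.2 S.Bperp_injective)
      (LinearMap.range_eq_top.2 S.Bperp_surjective)).symm :
      StrongDual ℝ Q →L[ℝ] S.Pkerᗮ)

theorem B_BminusL (y : StrongDual ℝ Q) : S.B (S.BminusL y) = y :=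
  (ContinuousLinearEquiv.ofBijective S.Bperp (LinearMap.ker_eq_bot.2 S.Bperp_injective)
      (LinearMap.range_eq_top.2 S.Bperp_surjective)).apply_symm_apply y

theorem Bminus_eq (y : StrongDual ℝ Q) : S.Bminus y = S.BminusL y := by
  obtain ⟨h1, h2⟩ := (S.exists_lift y).choose_spec
  have h3 : S.BminusL y ∈ S.Pkerᗮ := Subtype.property _
  have h4 : S.Bperp ⟨S.Bminus y, h1⟩ = S.Bperp ⟨S.BminusL y, h3⟩ := h2.trans (S.B_BminusL y).symm
  exact congrArg Subtype.val (S.Bperp_injective h4)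

/-- Surjectivity of `B` dualizes to injectivity of `B*`; this makes the multiplier unique. -/
theorem Bdual_injective : Function.Injective S.Bdual := by
  rw [injective_iff_map_eq_zero]
  intro μ hμ
  have h : ∀ y : StrongDual ℝ Q, y μ = 0 := fun y => by
    rw [← S.B_BminusL y]
    exact congrArg (fun F : StrongDual ℝ P => F (S.BminusL y)) hμ
  simpa using h (InnerProductSpace.toDual ℝ Q μ)

/-- The left inverse of `B*`. -/
def multiplier : StrongDual ℝ P →L[ℝ] Q :=
  (riesz Q).comp ((ContinuousLinearMap.compL ℝ Q P ℝ).flip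
    (S.BminusL.comp ((rieszEquiv Q).symm : Q →L[ℝ] StrongDual ℝ Q)))

/-- Since `q - B⁻ B q` lies in `P_ker`, the functional satisfies `G q = G (B⁻ B q)`. It depends on
`q` only through `B q`, so it comes from an element of `Q`. -/
theorem Bdual_multiplier {G : StrongDual ℝ P} (hG : S.restrictL G = 0) :
    S.Bdual (S.multiplier G) = G := by
  ext q
  change S.B q (S.multiplier G) = G q
  obtain ⟨ν, hν⟩ := (InnerProductSpace.toDual ℝ Q).surjective (S.B q)
  have h1 : S.B q (S.multiplier G) = G (S.BminusL (S.B q)) := by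
    conv_lhs => rw [← hν]
    rw [InnerProductSpace.toDual_apply_apply, real_inner_comm, multiplier,
      ContinuousLinearMap.comp_apply, inner_riesz, ← hν]
    rfl
  have h2 : q - S.BminusL (S.B q) ∈ S.Pker := by
    rw [mem_Pker, map_sub, B_BminusL, sub_self]
  have h3 : G (q - S.BminusL (S.B q)) = 0 :=
    congrArg (fun F : StrongDual ℝ S.Pker => F ⟨_, h2⟩) hG
  rw [h1]
  rw [map_sub] at h3
  linarith

/-- The residual of the first equation, as a distribution. -/
def residual (T : ℝ) (v z : ℝ → StrongDual ℝ P) :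
    𝓓(timeInterval T, ℝ) →L[ℝ] StrongDual ℝ P :=
  (TestFunction.integralAgainstBilinCLM (ContinuousLinearMap.lsmul ℝ ℝ) (timeMeasure T) v).comp
    (TestFunction.lineDerivCLM ℝ (1 : ℝ) : 𝓓(timeInterval T, ℝ) →L[ℝ] 𝓓(timeInterval T, ℝ))
  + TestFunction.integralAgainstBilinCLM (ContinuousLinearMap.lsmul ℝ ℝ) (timeMeasure T) z

theorem residual_apply {T : ℝ} {v z : ℝ → StrongDual ℝ P} (hv : Integrable v (timeMeasure T))
    (hz : Integrable z (timeMeasure T)) (φ : 𝓓(timeInterval T, ℝ)) :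
    residual T v z φ = ∫ t, deriv φ t • v t ∂(timeMeasure T)
      + ∫ t, φ t • z t ∂(timeMeasure T) := by
  have hl : ∀ {v : ℝ → StrongDual ℝ P}, Integrable v (timeMeasure T) →
      LocallyIntegrableOn v (timeInterval T) (timeMeasure T) := fun h =>
    h.locallyIntegrable.locallyIntegrableOn _
  rw [residual, _root_.add_apply, ContinuousLinearMap.comp_apply,
    TestFunction.integralAgainstBilinCLM_eq_integral (hl hv),
    TestFunction.integralAgainstBilinCLM_eq_integral (hl hz)]
  congr 1

theorem memL2_restrictL {T : ℝ} {v : ℝ → StrongDual ℝ P} (hv : MemL2 T v) :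
    MemL2 T (fun t => S.restrictL (v t)) := by
  have h := MemL2.clm (Y := StrongDual ℝ S.Pker) hv S.restrictL
  exact h

theorem memL2_embKer {T : ℝ} {w : ℝ → H} (hw : MemL2 T w) :
    MemL2 T (fun t => S.embKer (w t)) := by
  have h := MemL2.clm (Y := StrongDual ℝ S.Pker) hw S.embKer
  exact h

theorem restrictL_integral_smul {T : ℝ} {φ : ℝ → ℝ} (hφ : Continuous φ) {v : ℝ → StrongDual ℝ P}
    (hv : Integrable v (timeMeasure T)) :
    S.restrictL (∫ t, φ t • v t ∂(timeMeasure T))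
      = ∫ t, φ t • S.restrictL (v t) ∂(timeMeasure T) := by
  have h := clm_integral_smul (Y := StrongDual ℝ S.Pker) S.restrictL hφ hv
  exact h

theorem isPrim_restrictL {T : ℝ} {u v : ℝ → StrongDual ℝ P} {c : StrongDual ℝ P}
    (h : IsPrim T u c v) :
    IsPrim T (fun t => S.restrictL (u t)) (S.restrictL c) (fun t => S.restrictL (v t)) := by
  have h' := IsPrim.clm (Y := StrongDual ℝ S.Pker) h S.restrictL
  exact h'

theorem prim_kerOp {T : ℝ} {u : ℝ → S.Pker} (hu : Integrable u (timeMeasure T)) (t : ℝ) :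
    prim T (fun t => S.kerOp (u t)) t = S.kerOp (prim T u t) := by
  have h := prim_clm (Y := StrongDual ℝ S.Pker) hu S.kerOp t
  exact h

end ConstrainedSystem
end

/-! ### Equivalence with the reduced equation, and uniqueness -/

noncomputable section

namespace ConstrainedSystem

variable {P H M Q : Type*}
  [NormedAddCommGroup P] [InnerProductSpace ℝ P] [CompleteSpace P]
  [NormedAddCommGroup H] [InnerProductSpace ℝ H] [CompleteSpace H]
  [NormedAddCommGroup M] [InnerProductSpace ℝ M] [CompleteSpace M]
  [NormedAddCommGroup Q] [InnerProductSpace ℝ Q] [CompleteSpace Q]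
  {S : ConstrainedSystem P H M Q} {T : ℝ} {g : ℝ → StrongDual ℝ P} {r : ℝ → StrongDual ℝ M}
    {h : ℝ → StrongDual ℝ Q} {x : H} {p : ℝ → P} {m : ℝ → M} {lam : 𝓓'(timeInterval T, Q)}

theorem memL2_flux (hp : MemL2 T p) (hm : MemL2 T m) (hg : MemL2 T g) :
    MemL2 T (fun t => g t - (S.AP (p t) - S.Kdual (m t))) :=
  MemLp.sub hg (MemLp.sub (hp.clm S.AP) (hm.clm S.Kdual))

/-- The reduced equation says that the residual of the first equation vanishes on `P_ker` for each
test function. Applying the bounded left inverse of `B*` to it gives the multiplier as a continuous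
map on test functions. -/
theorem exists_isWeakSolution (hp : MemL2 T p) (hm : MemL2 T m) (hg : MemL2 T g)
    (hinit : HasInitialValue T (fun t => S.emb (p t)) x)
    (hred : HasWeakDeriv T (fun t => S.embKer (S.emb (p t)))
      (fun t => S.restrictL (g t - (S.AP (p t) - S.Kdual (m t)))))
    (hr : ∀ᵐ t ∂(timeMeasure T), S.K (p t) + S.D (m t) = r t)
    (hh : ∀ᵐ t ∂(timeMeasure T), S.B (p t) = h t) :
    ∃ lam, S.IsWeakSolution T g r h x p m lam := by
  set v : ℝ → StrongDual ℝ P := fun t => S.embDual (S.emb (p t)) with hv_def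
  set z : ℝ → StrongDual ℝ P := fun t => g t - (S.AP (p t) - S.Kdual (m t)) with hz_def
  have hv : Integrable v (timeMeasure T) := (hp.clm (S.embDual.comp S.emb)).integrable
  have hz : Integrable z (timeMeasure T) := (memL2_flux hp hm hg).integrable
  have hy : Integrable (fun t => S.AP (p t) - S.Kdual (m t)) (timeMeasure T) :=
    MemL2.integrable (MemLp.sub (hp.clm S.AP) (hm.clm S.Kdual))
  let G : 𝓓(timeInterval T, ℝ) →L[ℝ] Q := S.multiplier.comp (residual T v z)
  have key : ∀ φ : 𝓓(timeInterval T, ℝ), 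
      S.Bdual (S.multiplier (residual T v z φ)) = residual T v z φ := fun φ => by
    refine S.Bdual_multiplier ?_
    rw [residual_apply hv hz, map_add,
      S.restrictL_integral_smul (testFunction_deriv_continuous φ) hv,
      S.restrictL_integral_smul φ.continuous hz, add_eq_zero_iff_eq_neg]
    exact hred.integral_eq φ
  refine ⟨⟨G.toLinearMap, G.cont⟩, hp, hm, hinit, fun φ => ?_, hr, hh⟩
  change _ + S.Bdual (S.multiplier (residual T v z φ)) = _
  rw [key, residual_apply hv hz]
  have e : ∫ t, φ t • z t ∂(timeMeasure T) = ∫ t, φ t • g t ∂(timeMeasure T)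
      - ∫ t, φ t • (S.AP (p t) - S.Kdual (m t)) ∂(timeMeasure T) := by
    rw [← integral_sub (φ.continuous.integrable_smul_timeMeasure hg.integrable)
      (φ.continuous.integrable_smul_timeMeasure hy)]
    simp only [hz_def, smul_sub]
  rw [e]
  abel

theorem IsWeakSolution.hasWeakDeriv (hs : S.IsWeakSolution T g r h x p m lam) (hg : MemL2 T g) :
    HasWeakDeriv T (fun t => S.embKer (S.emb (p t)))
      (fun t => S.restrictL (g t - (S.AP (p t) - S.Kdual (m t)))) := by
  have hz := memL2_flux (S := S) hs.memL2_p hs.memL2_m hg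
  have hv : MemL2 T (fun t => S.embDual (S.emb (p t))) := (hs.memL2_p.clm S.emb).clm S.embDual
  have hy : Integrable (fun t => S.AP (p t) - S.Kdual (m t)) (timeMeasure T) :=
    MemL2.integrable (MemLp.sub (hs.memL2_p.clm S.AP) (hs.memL2_m.clm S.Kdual))
  refine ⟨(S.memL2_restrictL hv).integrable.locallyIntegrableOn_Ioo,
    (S.memL2_restrictL hz).integrable.locallyIntegrableOn_Ioo, fun φ => ?_⟩
  have e1 := S.restrictL_integral_smul (testFunction_deriv_continuous φ) hv.integrable
  have e2 := S.restrictL_integral_smul φ.continuous hz.integrable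
  have e3 : ∫ t, φ t • (g t - (S.AP (p t) - S.Kdual (m t))) ∂(timeMeasure T)
      = ∫ t, φ t • g t ∂(timeMeasure T)
      - ∫ t, φ t • (S.AP (p t) - S.Kdual (m t)) ∂(timeMeasure T) := by
    rw [← integral_sub (φ.continuous.integrable_smul_timeMeasure hg.integrable)
      (φ.continuous.integrable_smul_timeMeasure hy)]
    simp only [smul_sub (φ _) (g _)]
  have h1 := congrArg S.restrictL (hs.eq_p φ)
  rw [map_add, restrictL_Bdual, add_zero, map_add, map_neg] at h1
  simp only [embKer_eq]
  rw [← e1, ← e2, e3, map_sub, ← h1]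
  abel

theorem IsWeakSolution.m_ae_eq (hs : S.IsWeakSolution T g r h x p m lam) :
    m =ᵐ[timeMeasure T] fun t => S.Dinv (r t - S.K (p t)) := by
  filter_upwards [hs.eq_m] with t ht
  rw [← ht, add_sub_cancel_left, Dinv_D]

theorem IsWeakSolution.ae_eq_prim (hT : 0 < T) (hs : S.IsWeakSolution T g r h x p m lam)
    (hg : MemL2 T g) : IsPrim T (fun t => S.embKer (S.emb (p t))) (S.embKer x)
      (fun t => S.restrictL (g t - (S.AP (p t) - S.Kdual (m t)))) := by
  have hz := memL2_flux (S := S) hs.memL2_p hs.memL2_m hg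
  obtain ⟨c, hc⟩ := IsPrim.of_hasWeakDeriv hT (u := fun t => S.embKer (S.emb (p t)))
    (S.memL2_embKer (hs.memL2_p.clm S.emb)) (S.memL2_restrictL hz) (hs.hasWeakDeriv hg)
  obtain ⟨w, hw, hpw, hw0⟩ := hs.initial
  have h1 : HasInitialValue T (fun t => S.embKer (S.emb (p t))) (S.embKer x) := by
    refine ⟨fun t => S.embKer (w t), S.embKer.continuous.comp_continuousOn hw, ?_,
      congrArg S.embKer hw0⟩
    filter_upwards [hpw] with t ht
    rw [ht]
  rw [← hc.hasInitialValue.unique hT h1]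
  exact hc

theorem IsWeakSolution.unique (hT : 0 < T) (hg : MemL2 T g) {p' : ℝ → P} {m' : ℝ → M}
    {lam' : 𝓓'(timeInterval T, Q)} (hs : S.IsWeakSolution T g r h x p m lam)
    (hs' : S.IsWeakSolution T g r h x p' m' lam') :
    p =ᵐ[timeMeasure T] p' ∧ m =ᵐ[timeMeasure T] m' ∧ lam = lam' := by
  -- The difference satisfies the constraint only almost everywhere; the projection makes it
  -- `P_ker`-valued for every `t` and keeps it in `L²`.
  let δ : ℝ → S.Pker := fun t => S.Pker.orthogonalProjectionOnto (p t - p' t)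
  have hδ : MemL2 T δ := MemL2.clm (MemLp.sub hs.memL2_p hs'.memL2_p) S.Pker.orthogonalProjectionOnto
  have hδe : ∀ᵐ t ∂(timeMeasure T), (δ t : P) = p t - p' t := by
    filter_upwards [hs.eq_lam, hs'.eq_lam] with t h1 h2
    have : p t - p' t ∈ S.Pker := by rw [mem_Pker, map_sub, h1, h2, sub_self]
    exact S.Pker.starProjection_eq_self_iff.2 this
  have hm : ∀ᵐ t ∂(timeMeasure T), m t - m' t = - S.Dinv (S.K (δ t)) := by
    filter_upwards [hs.m_ae_eq, hs'.m_ae_eq, hδe] with t h1 h2 h3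
    rw [h1, h2, h3, ← map_sub, ← map_neg]
    congr 1
    rw [map_sub]
    abel
  have hδ0 : δ =ᵐ[timeMeasure T] 0 := by
    refine S.ker_solution_unique hδ.integrable ?_
    have h1 := (hs.ae_eq_prim hT hg).sub (hs'.ae_eq_prim hT hg)
    have h2 : (fun t => S.restrictL (g t - (S.AP (p t) - S.Kdual (m t)))
        - S.restrictL (g t - (S.AP (p' t) - S.Kdual (m' t))))
        =ᵐ[timeMeasure T] fun t => - S.kerOp (δ t) := by
      filter_upwards [hm, hδe] with t h1 h2
      have h3 : S.Kdual (m t) - S.Kdual (m' t) = - S.L (δ t) := by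
        rw [← map_sub, h1, map_neg, L_apply]
      have h4 : S.AP (p t) - S.AP (p' t) = S.AP (δ t) := by rw [← map_sub, h2]
      rw [kerOp_apply, ← map_sub, ← map_neg, ← h4]
      congr 1
      rw [neg_add, ← h3]
      abel
    filter_upwards [h1.ae_eq, hδe] with t h3 h4
    rw [prim_congr h2, prim_neg, prim_kerOp S hδ.integrable, sub_self, zero_add, ← map_sub,
      ← map_sub, ← h4] at h3
    rw [h3, neg_add_cancel]
  have hpp : p =ᵐ[timeMeasure T] p' := by
    filter_upwards [hδe, hδ0] with t h1 h2
    rw [h2] at h1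
    exact sub_eq_zero.1 h1.symm
  have hmm : m =ᵐ[timeMeasure T] m' := by
    filter_upwards [hm, hδ0] with t h1 h2
    rw [h2] at h1
    simpa [sub_eq_zero] using h1
  refine ⟨hpp, hmm, ?_⟩
  ext φ
  refine S.Bdual_injective ?_
  have h1 := hs.eq_p φ
  have h2 := hs'.eq_p φ
  have e1 : ∫ t, deriv φ t • S.embDual (S.emb (p t)) ∂(timeMeasure T)
      = ∫ t, deriv φ t • S.embDual (S.emb (p' t)) ∂(timeMeasure T) := by
    refine integral_congr_ae ?_
    filter_upwards [hpp] with t ht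
    rw [ht]
  have e2 : ∫ t, φ t • (S.AP (p t) - S.Kdual (m t)) ∂(timeMeasure T)
      = ∫ t, φ t • (S.AP (p' t) - S.Kdual (m' t)) ∂(timeMeasure T) := by
    refine integral_congr_ae ?_
    filter_upwards [hpp, hmm] with t ht ht'
    rw [ht, ht']
  rw [e1, e2, ← h2] at h1
  exact add_left_cancel h1

end ConstrainedSystem
end

/-! ### Existence for the corrector and regularity for the limit system -/

noncomputable section

theorem IsPrim.congr_right {X : Type*} [NormedAddCommGroup X] [NormedSpace ℝ X]
    {T : ℝ} {u v v' : ℝ → X} {c : X} (h : IsPrim T u c v) (hv : v =ᵐ[timeMeasure T] v') :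
    IsPrim T u c v' :=
  ⟨(memLp_congr_ae hv).1 h.memL2, by rw [← prim_congr hv]; exact h.ae_eq⟩

theorem MemH1.exists_isPrim {X : Type*} [NormedAddCommGroup X] [NormedSpace ℝ X] [CompleteSpace X]
    {T : ℝ} (hT : 0 < T) {u : ℝ → X} (h : MemH1 T u) : ∃ c v, IsPrim T u c v := by
  obtain ⟨hu, v, hv, huv⟩ := h
  obtain ⟨c, hc⟩ := IsPrim.of_hasWeakDeriv hT hu hv huv
  exact ⟨c, v, hc⟩

namespace ConstrainedSystem

variable {P H M Q : Type*}
  [NormedAddCommGroup P] [InnerProductSpace ℝ P] [CompleteSpace P]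
  [NormedAddCommGroup H] [InnerProductSpace ℝ H] [CompleteSpace H]
  [NormedAddCommGroup M] [InnerProductSpace ℝ M] [CompleteSpace M]
  [NormedAddCommGroup Q] [InnerProductSpace ℝ Q] [CompleteSpace Q]
  (S : ConstrainedSystem P H M Q)

theorem flux_eq (γ : StrongDual ℝ P) (p : P) (r : StrongDual ℝ M) :
    γ - (S.AP p - S.Kdual (S.Dinv (r - S.K p)))
      = γ + S.Kdual (S.Dinv r) - (S.AP p + S.L p) := by
  rw [map_sub, map_sub, ← L_apply]
  abel

theorem K_add_D_Dinv (p : P) (r : StrongDual ℝ M) :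
    S.K p + S.D (S.Dinv (r - S.K p)) = r := by
  rw [D_Dinv, add_sub_cancel]

theorem memL2_kerOp {T : ℝ} {u : ℝ → S.Pker} (hu : MemL2 T u) :
    MemL2 T (fun t => S.kerOp (u t)) := by
  have h := MemL2.clm (Y := StrongDual ℝ S.Pker) hu S.kerOp
  exact h

theorem exists_homogeneous_solution {T : ℝ} (hT : 0 < T) {r : ℝ → StrongDual ℝ M}
    (hr : MemL2 T r) : ∃ (p : ℝ → S.Pker) (m : ℝ → M) (lam : 𝓓'(timeInterval T, Q)),
      MemL2 T p ∧ MemL2 T m ∧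
      S.IsWeakSolution T (fun _ => 0) r (fun _ => 0) 0 (fun t => (p t : P)) m lam := by
  have hF : MemL2 T (fun t => S.restrictL (S.Kdual (S.Dinv (r t)))) :=
    S.memL2_restrictL ((hr.clm S.Dinv).clm S.Kdual)
  obtain ⟨u, w, hu, hw, huw, hw0, heq⟩ := S.exists_ker_solution hT hF S.Hker.zero_mem
  have hp : MemL2 T (fun t => (u t : P)) := hu.clm S.Pker.subtypeL
  have hm : MemL2 T (fun t => S.Dinv (r t - S.K (u t))) :=
    MemL2.clm (MemLp.sub hr (hp.clm S.K)) S.Dinv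
  have hg : MemL2 T (fun _ => (0 : StrongDual ℝ P)) := MemLp.zero
  have hflux := S.memL2_restrictL (memL2_flux (S := S) hp hm hg)
  have hkey : ∀ t, S.restrictL (0 - (S.AP (u t) - S.Kdual (S.Dinv (r t - S.K (u t)))))
      = S.restrictL (S.Kdual (S.Dinv (r t))) - S.kerOp (u t) := fun t => by
    rw [flux_eq, zero_add, map_sub, kerOp_apply]
  have hku := S.memL2_kerOp hu
  have hprim : IsPrim T (fun t => S.embKer (S.emb (u t))) 0
      (fun t => S.restrictL (0 - (S.AP (u t) - S.Kdual (S.Dinv (r t - S.K (u t)))))) := by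
    refine ⟨hflux, ?_⟩
    filter_upwards [huw, ae_timeMeasure_mem T] with t h1 h2
    have h3 := heq t (Ioo_subset_Icc_self h2)
    rw [map_zero, zero_add] at h3
    rw [h1, zero_add, funext hkey, prim_sub hF.integrable hku.integrable, ← h3, prim_kerOp S hu.integrable,
      add_sub_cancel_right]
  obtain ⟨lam, hlam⟩ := exists_isWeakSolution (S := S) (g := fun _ => 0) (r := r)
    (h := fun _ => 0) (x := 0) hp hm hg ⟨w, hw, huw, hw0⟩ (hprim.hasWeakDeriv hT)
    (Filter.Eventually.of_forall fun t => S.K_add_D_Dinv _ _)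
    (Filter.Eventually.of_forall fun t => S.B_coe _)
  exact ⟨u, _, lam, hu, hm, hlam⟩

set_option maxHeartbeats 1000000 in
-- Write `p = q + B⁻ h` with `q` in `P_ker`. Instead of showing that a given solution is
-- differentiable, the time derivative `u` of `q` is built first, as the solution of the
-- differentiated equation, and `q` is its primitive.
theorem exists_regular_solution {T : ℝ} (hT : 0 < T) {f : ℝ → StrongDual ℝ M}
    {g : ℝ → StrongDual ℝ P} {h : ℝ → StrongDual ℝ Q} {pInit : P} (hf : MemH1 T f)
    (hg : MemL2 T g) (hg' : MemH1 T (fun t => S.restrictKer (g t))) (hh : MemH2 T h)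
    (hcons : S.B pInit = initialValue T h) (hcomp : S.Compatible T f g h pInit) :
    ∃ (p : ℝ → P) (m : ℝ → M) (lam : 𝓓'(timeInterval T, Q)),
      S.IsWeakSolution T g f h (S.emb pInit) p m lam ∧ ∃ c v, IsPrim T m c v := by
  obtain ⟨cf, f₁, hf₁⟩ := hf.exists_isPrim hT
  obtain ⟨cg, g₁, hg₁⟩ := MemH1.exists_isPrim (X := StrongDual ℝ S.Pker) hT hg'
  obtain ⟨hhL, h₁, hh₁, hhd⟩ := hh
  obtain ⟨ch, hhp⟩ := IsPrim.of_hasWeakDeriv hT hhL hh₁.1 hhd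
  obtain ⟨ch₁, h₂, hh₂⟩ := hh₁.exists_isPrim hT
  have ef : initialValue T f = cf := hf₁.hasInitialValue.initialValue_eq hT
  have eg : initialValue T (fun t => S.restrictKer (g t)) = cg :=
    hg₁.hasInitialValue.initialValue_eq hT
  have eh : initialValue T h = ch := hhp.hasInitialValue.initialValue_eq hT
  have eh₁ : initialValue T (weakDeriv T h) = ch₁ :=
    (hh₂.hasInitialValue.congr hhd.weakDeriv_ae_eq.symm).initialValue_eq hT
  obtain ⟨w₀, hw₀, hcompat⟩ := hcomp
  rw [ef, eg, eh₁, Bminus_eq] at hcompat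
  have hb := hhp.clm S.BminusL
  have hq₀ : pInit - S.BminusL ch ∈ S.Pker := by
    rw [mem_Pker, map_sub, hcons, eh, B_BminusL, sub_self]
  set q₀ : S.Pker := ⟨pInit - S.BminusL ch, hq₀⟩ with hq₀_def
  let N : P →L[ℝ] StrongDual ℝ P := S.AP + S.L
  have hN : ∀ p, N p = S.AP p + S.L p := fun _ => rfl
  -- The right-hand side of the equation for `q`: `K* D⁻¹ f - (A + L) B⁻ h - B⁻ h' + g` on `P_ker`.
  -- The term `B⁻ h'` is why `h` must be in `H²`.
  have hΦ := (S.isPrim_restrictL ((((hf₁.clm S.Dinv).clm S.Kdual).sub (hb.clm N)).sub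
    (((hh₂.clm S.BminusL).clm S.emb).clm S.embDual))).add hg₁
  obtain ⟨u, w, hu, hw, huw, hw0, heq⟩ := S.exists_ker_solution hT hΦ.memL2 hw₀
  have hq : IsPrim T (fun t => q₀ + prim T u t) q₀ u := ⟨hu, Filter.EventuallyEq.rfl⟩
  have hp := (hq.clm S.Pker.subtypeL).add hb
  have hpc : S.Pker.subtypeL q₀ + S.BminusL ch = pInit := by
    change pInit - S.BminusL ch + S.BminusL ch = pInit
    abel
  rw [hpc] at hp
  set p : ℝ → P := fun t => S.Pker.subtypeL (q₀ + prim T u t) + S.BminusL (h t) with hp_def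
  have hm := (hf₁.sub (hp.clm S.K)).clm S.Dinv
  -- Compatibility rewritten with `p⁰ = q₀ + B⁻ h(0)`: it is the equation for `q` at time `0`, with
  -- `w₀` in the place of `q'(0)`.
  have hw₀' : S.embKer w₀ = S.restrictL (S.Kdual (S.Dinv cf) - N (S.BminusL ch)
      - S.embDual (S.emb (S.BminusL ch₁))) + cg - S.kerOp q₀ := by
    ext q
    have h1 := hcompat q
    have h2 : N pInit q = N (S.BminusL ch) q + S.kerOp q₀ q := by
      change N pInit q = N (S.BminusL ch) q + N (pInit - S.BminusL ch) q
      rw [map_sub, sub_apply]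
      ring
    have h3 : (S.L pInit + S.AP pInit) q = N pInit q := by rw [hN, add_comm]
    rw [h3, h2] at h1
    rw [embKer_apply, sub_apply, _root_.add_apply, restrictL_apply, sub_apply, sub_apply]
    change ⟪w₀, S.emb q⟫ = _
    rw [h1]
    ring
  -- The integrated equation for `u`, with its constant matched by `hw₀'`, is the reduced equation
  -- for `p`, whose derivative is `u + B⁻ h'`.
  have hder : (fun t => S.embKer (S.emb (S.Pker.subtypeL (u t) + S.BminusL (h₁ t))))
      =ᵐ[timeMeasure T]
      fun t => S.restrictL (g t - (S.AP (p t) - S.Kdual (S.Dinv (f t - S.K (p t))))) := by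
    filter_upwards [huw, hΦ.ae_eq, ae_timeMeasure_mem T] with t h1 h2 h3
    have h4 := heq t (Ioo_subset_Icc_self h3)
    have h5 : S.embKer (S.emb (u t)) + S.kerOp (q₀ + prim T u t)
        = S.restrictL (S.Kdual (S.Dinv (f t)) - N (S.BminusL (h t))
          - S.embDual (S.emb (S.BminusL (h₁ t)))) + S.restrictL (g t) := by
      refine Eq.trans ?_ h2.symm
      rw [h1, map_add, add_left_comm, h4, hw₀']
      abel
    have h6 : S.kerOp (q₀ + prim T u t) = S.restrictL (N (S.Pker.subtypeL (q₀ + prim T u t))) := rfl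
    have h7 : S.embKer (S.emb (S.Pker.subtypeL (u t) + S.BminusL (h₁ t)))
        = S.embKer (S.emb (u t)) + S.restrictL (S.embDual (S.emb (S.BminusL (h₁ t)))) := by
      rw [map_add, map_add]; rfl
    rw [h7, eq_sub_of_add_eq h5, h6, flux_eq, ← hN, hp_def]
    simp only [map_add, map_sub]
    abel
  have hred := (IsPrim.clm (Y := StrongDual ℝ S.Pker) (hp.clm S.emb) S.embKer).congr_right hder
  obtain ⟨lam, hlam⟩ := exists_isWeakSolution (S := S) (r := f) (h := h) hp.memL2_left
    hm.memL2_left hg (hp.clm S.emb).hasInitialValue (hred.hasWeakDeriv hT)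
    (Filter.Eventually.of_forall fun t => S.K_add_D_Dinv _ _)
    (Filter.Eventually.of_forall fun t => by
      change S.B (_ + _) = _
      rw [map_add, B_BminusL]
      change S.B ((q₀ + prim T u t : S.Pker) : P) + _ = _
      rw [B_coe, zero_add])
  exact ⟨p, _, lam, hlam, _, _, hm⟩

end ConstrainedSystem

end

/-! ### The limit system and its first-order corrector -/

theorem proposition3p9 {P H M Q : Type*}
    [NormedAddCommGroup P] [InnerProductSpace ℝ P] [CompleteSpace P]
    [NormedAddCommGroup H] [InnerProductSpace ℝ H] [CompleteSpace H]
    [NormedAddCommGroup M] [InnerProductSpace ℝ M] [CompleteSpace M]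
    [NormedAddCommGroup Q] [InnerProductSpace ℝ Q] [CompleteSpace Q]
    (S : ConstrainedSystem P H M Q) (T : ℝ) (hT : 0 < T)
    (f : ℝ → StrongDual ℝ M) (g : ℝ → StrongDual ℝ P) (h : ℝ → StrongDual ℝ Q) (pInit : P)
    (hf : MemH1 T f)
    (hg : MemL2 T g) (hg' : MemH1 T (fun t => S.restrictKer (g t)))
    (hh : MemH2 T h)
    (hcons : S.B pInit = initialValue T h)
    (hcomp : S.Compatible T f g h pInit) :
    -- the limit system has a weak solution, and for any such solution `(p₀, m₀, lam₀)` ...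
    (∃ (p₀ : ℝ → P) (m₀ : ℝ → M) (lam₀ : 𝓓'(timeInterval T, Q)),
      S.IsWeakSolution T g f h (S.emb pInit) p₀ m₀ lam₀) ∧
    ∀ (p₀ : ℝ → P) (m₀ : ℝ → M) (lam₀ : 𝓓'(timeInterval T, Q)),
      S.IsWeakSolution T g f h (S.emb pInit) p₀ m₀ lam₀ →
      -- ... the derivative `m₀'` exists in `L²(0,T;M)` and the corrector system with right-hand
      -- sides `0`, `-m₀'`, `0` and initial value `0` is uniquely solvable
      MemH1 T m₀ ∧
      ∃ (p₁ : ℝ → S.Pker) (m₁ : ℝ → M) (lam₁ : 𝓓'(timeInterval T, Q)),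
        MemL2 T p₁ ∧ MemL2 T m₁ ∧
        S.IsWeakSolution T (fun _ => 0)
          (fun t => -InnerProductSpace.toDual ℝ M (weakDeriv T m₀ t)) (fun _ => 0) 0
          (fun t => (p₁ t : P)) m₁ lam₁ ∧
        ∀ (p : ℝ → P) (m : ℝ → M) (lam : 𝓓'(timeInterval T, Q)),
          S.IsWeakSolution T (fun _ => 0)
            (fun t => -InnerProductSpace.toDual ℝ M (weakDeriv T m₀ t)) (fun _ => 0) 0
            p m lam →
          p =ᵐ[timeMeasure T] (fun t => (p₁ t : P)) ∧ m =ᵐ[timeMeasure T] m₁ ∧ lam = lam₁ := by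
  obtain ⟨p, m, lam, hsol, c, v, hprim⟩ :=
    S.exists_regular_solution hT hf hg hg' hh hcons hcomp
  refine ⟨⟨p, m, lam, hsol⟩, fun p₀ m₀ lam₀ h₀ => ?_⟩
  -- Uniqueness transfers the regularity of the constructed solution to an arbitrary one.
  have hm₀ : IsPrim T m₀ c v := hprim.congr (hsol.unique hT hg h₀).2.1
  have hv : MemL2 T (weakDeriv T m₀) :=
    (memLp_congr_ae (hm₀.hasWeakDeriv hT).weakDeriv_ae_eq).2 hm₀.memL2
  have hr : MemL2 T (fun t => -InnerProductSpace.toDual ℝ M (weakDeriv T m₀ t)) :=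
    MemLp.neg (hv.clm ((rieszEquiv M).symm : M →L[ℝ] StrongDual ℝ M))
  obtain ⟨p₁, m₁, lam₁, hp₁, hm₁, h₁⟩ := S.exists_homogeneous_solution hT hr
  exact ⟨hm₀.memH1 hT, p₁, m₁, lam₁, hp₁, hm₁, h₁, fun p' m' lam' h' =>
    h'.unique hT MemLp.zero h₁⟩
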